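/- **Theorem 5.2 (utility of DPTD under state-action-state).** *Setting.* Let $d\ge 1$, let $\Theta,\Omega\subseteq\mathbb R^d$ be closed convex sets, let $\Xi$ be a probability law on a measurable space of data points $\xi$, let $f(\theta,\omega;\xi)$ be a jointly measurable real-valued loss, and put $F(\theta,\omega)=\mathbb E_{\xi\sim\Xi}[f(\theta,\omega;\xi)]$, $J(\theta)=\max_{\omega\in\Omega}F(\theta,\omega)$, $\omega^*(\theta)=\arg\max_{\omega\in\Omega}F(\theta,\omega)$. All norms are Euclidean. Assume: 1. (Existence of solutions) $J$ attains its minimum over $\Theta$ at some $\theta^*\in\Theta$. 2. ($L_F$-smoothness) $f(\cdot,\cdot;\xi)$, for every $\xi$, and $F$ are differentiable at every point of $\Theta\times\Omega$, and $\|\nabla F(\theta,\omega)-\nabla F(\theta',\omega')\|\le L_F\|(\theta,\omega)-(\theta',\omega')\|$ for all $(\theta,\omega),(\theta',\omega')\in\Theta\times\Omega$. 3. (Stochastic $G$-Lipschitz, $G\ge 0$) On some convex set $D\supseteq\Theta\times\Omega$ with nonempty interior (for instance $D=\mathbb R^d\times\mathbb R^d$, or $D=\Theta\times\Omega$ if it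 has interior points), $f(\theta,\omega;\cdot)$ is $\Xi$-integrable for every $(\theta,\omega)\in D$ and $|f(\theta,\omega;\xi)-f(\theta',\omega';\xi)|\le G\|(\theta,\omega)-(\theta',\omega')\|$ for every $\xi$ and all $(\theta,\omega),(\theta',\omega')\in D$. 4. (Strong concavity) For every $\theta\in\Theta$, $F(\theta,\cdot)$ is $\mu$-strongly concave on $\Omega$, where $0<\mu\le L_F$. 5. (I.i.d. sampling) The data points $\xi_0,\xi_1,\dots$ used by the algorithm are i.i.d. with law $\Xi$. *Algorithm (DPTD).* Given $\kappa,\eta,\alpha,\beta>0$, $\nu_t>0$, $\theta_0\in\Theta$, $\omega_0\in\Omega$, set $p_0=\nabla_\theta f(\theta_0,\omega_0;\xi_0)+u^p_0$, $d_0=\nabla_\omega f(\theta_0,\omega_0;\xi_0)+u^d_0$, and for $t=0,1,\dots,T-1$ $$\tilde\theta_{t+1}=\mathcal P_\Theta(\theta_t-\kappa p_t),\quad \tilde\omega_{t+1}=\mathcal P_\Omega(\omega_t+\eta d_t),\quad \theta_{t+1}=\theta_t+\nu_t(\tilde\theta_{t+1}-\theta_t),\quad \omega_{t+1}=\omega_t+\nu_t(\tilde\omega_{t+1}-\omega_t),$$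 $$p_{t+1}=(1-\alpha\nu_t)p_t+\alpha\nu_t\nabla_\theta f(\theta_{t+1},\omega_{t+1};\xi_{t+1})+u^p_{t+1},\quad d_{t+1}=(1-\beta\nu_t)d_t+\beta\nu_t\nabla_\omega f(\theta_{t+1},\omega_{t+1};\xi_{t+1})+u^d_{t+1},$$ where $\mathcal P$ denotes Euclidean projection and the noises $u^p_t,u^d_t\sim N(0,\sigma_t^2 I_d)$ are independent of each other and of the data points. The output $(\bar\theta,\bar\omega)=(\theta_R,\omega_R)$ has $R$ uniform on $\{0,\dots,T-1\}$ and independent of everything else, and its utility is $\mathfrak M(\bar\theta,\bar\omega)=\mathfrak M_R$, where $$\mathfrak M_t=\mathfrak M(\theta_t,\omega_t)=\kappa^{-1}\|\tilde\theta_{t+1}-\theta_t\|+\|\nabla_\theta F(\theta_t,\omega_t)-p_t\|+L_F\|\omega_t-\omega^*(\theta_t)\|.$$ *Parameters.* Let $\alpha=\beta=3$, $0<\eta\le\mu/(4L_F^2)$, $0<\kappa\le\eta\mu^2/(9L_F^2)$, $\nu_t=\frac{1}{4(t+b)^{1/2}}$ with $b\ge\max\{(2\kappa L_F^2/\mu)^2,3\}$.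 Let $n\ge1$ be an integer (the dataset size), $\epsilon>0$, $\delta\in(0,1)$, $\beta'\in(0,1)$, and let $C,c>0$ be constants with $\epsilon\le c\log(1/\delta)$. Let $$T=\left\lfloor\frac{Cn\epsilon}{\sqrt{d\log(1/\delta)}}\right\rfloor\ge1,\qquad \sigma_t^2=\frac{14G^2T\alpha'}{n^2\left(\epsilon-\frac{\log(1/\delta)}{\alpha'-1}\right)}=\frac{14G^2T\alpha'}{n^2\beta'\epsilon}\ \ (t\ge0),\qquad \alpha'=\frac{\log(1/\delta)}{(1-\beta')\epsilon}+1.$$ *Conclusion.* Let $\Delta$ be any upper bound for $J(\theta_0)-J(\theta^*)$. There is a constant $K>0$, depending only on $G,L_F,\mu,\eta,\kappa,b,\beta',C,c,\Delta$, such that $\mathfrak M(\bar\theta,\bar\omega)$ is integrable and $$\mathbb E\left[\mathfrak M(\bar\theta,\bar\omega)\right]\le K\,\frac{(d\log(1/\delta))^{1/8}}{(n\epsilon)^{1/4}}\sqrt{\log(T+b)}=\widetilde{\mathcal O}\left(\frac{(d\log(1/\delta))^{1/8}}{(n\epsilon)^{1/4}}\right).$$ Moreover, the initialization and the $T$ iterations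 evaluate exactly $2(T+1)$ gradients of $f$, and $2(T+1)\le K\,\frac{n\epsilon}{\sqrt{d\log(1/\delta)}}$. -/

import Mathlib

open MeasureTheory ProbabilityTheory

noncomputable section

namespace DPTD

/-- The parameter space `ℝ^d` with its Euclidean norm. -/
abbrev Vec (d : ℕ) := EuclideanSpace ℝ (Fin d)

section Basic

variable {d : ℕ}

/-- Euclidean projection onto `K`: a point of `K` at minimal distance from `x`
(it exists and is unique when `K` is nonempty, closed and convex). -/
def proj (K : Set (Vec d)) (x : Vec d) : Vec d :=
  Classical.epsilon fun y => y ∈ K ∧ ∀ z ∈ K, ‖x - y‖ ≤ ‖x - z‖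

/-- A maximizer of `g` over `K` (it exists and is unique when `K` is nonempty, closed and convex
and `g` is continuous and strongly concave on `K`). -/
def argmaxOn (K : Set (Vec d)) (g : Vec d → ℝ) : Vec d :=
  Classical.epsilon fun y => y ∈ K ∧ ∀ z ∈ K, g z ≤ g y

/-- The `ℓ²` norm of the concatenation `(x, y)`. -/
def pairNorm (x y : Vec d) : ℝ := Real.sqrt (‖x‖ ^ 2 + ‖y‖ ^ 2)

/-- Partial gradient in the primal variable `θ`. -/
def gradTheta (g : Vec d → Vec d → ℝ) (θ ω : Vec d) : Vec d :=
  gradient (fun x => g x ω) θ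

/-- Partial gradient in the dual variable `ω`. -/
def gradOmega (g : Vec d → Vec d → ℝ) (θ ω : Vec d) : Vec d :=
  gradient (fun y => g θ y) ω

/-- The primal function `J(θ) = max_{ω ∈ W} F(θ, ω)`. -/
def primal (F : Vec d → Vec d → ℝ) (W : Set (Vec d)) (θ : Vec d) : ℝ :=
  sSup (F θ '' W)

end Basic

section Objective

variable {d : ℕ} {Z : Type*} [MeasurableSpace Z]

/-- The objective `F(θ, ω) = E_{ξ ∼ Ξ} [f(θ, ω; ξ)]`. -/
def objective (f : Vec d → Vec d → Z → ℝ) (Ξ : Measure Z) (θ ω : Vec d) : ℝ :=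
  ∫ ξ, f θ ω ξ ∂Ξ

/-- The assumptions on the loss `f`, the data law `Ξ` and the feasible sets `Θ`, `W`.

The stochastic Lipschitz condition is imposed on a convex set `D ⊇ Θ × W` with nonempty interior.
This allows `D = ℝ^d × ℝ^d`, and also `D = Θ × W` when that product has interior points. -/
structure Assumptions (f : Vec d → Vec d → Z → ℝ) (Ξ : Measure Z)
    (Θ W : Set (Vec d)) (D : Set (Vec d × Vec d)) (L_F G μ : ℝ) : Prop where
  /-- The loss is jointly measurable. -/
  measurable_loss : Measurable fun q : (Vec d × Vec d) × Z => f q.1.1 q.1.2 q.2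
  subset_dom : Θ ×ˢ W ⊆ D
  convex_dom : Convex ℝ D
  interior_dom : (interior D).Nonempty
  /-- The objective is well defined. -/
  integrable_loss : ∀ z ∈ D, Integrable (f z.1 z.2) Ξ
  /-- The stochastic gradients used by the algorithm exist. -/
  differentiable_loss : ∀ θ ∈ Θ, ∀ ω ∈ W, ∀ ξ,
    DifferentiableAt ℝ (fun z : Vec d × Vec d => f z.1 z.2 ξ) (θ, ω)
  /-- The gradient of the objective exists. -/
  differentiable_objective : ∀ θ ∈ Θ, ∀ ω ∈ W,
    DifferentiableAt ℝ (fun z : Vec d × Vec d => objective f Ξ z.1 z.2) (θ, ω)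
  /-- Existence of solutions. -/
  exists_solution : ∃ θs ∈ Θ, IsMinOn (primal (objective f Ξ) W) Θ θs
  /-- Lipschitz continuity of `∇F = (∇_θ F, ∇_ω F)`. -/
  smooth : ∀ θ ∈ Θ, ∀ θ' ∈ Θ, ∀ ω ∈ W, ∀ ω' ∈ W,
    pairNorm
        (gradTheta (objective f Ξ) θ ω - gradTheta (objective f Ξ) θ' ω')
        (gradOmega (objective f Ξ) θ ω - gradOmega (objective f Ξ) θ' ω')
      ≤ L_F * pairNorm (θ - θ') (ω - ω')
  /-- Stochastic `G`-Lipschitz condition. -/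
  lipschitz : ∀ ξ, ∀ z ∈ D, ∀ z' ∈ D,
    |f z.1 z.2 ξ - f z'.1 z'.2 ξ| ≤ G * pairNorm (z.1 - z'.1) (z.2 - z'.2)
  /-- The feasible sets are closed and convex. -/
  closed_primal : IsClosed Θ
  convex_primal : Convex ℝ Θ
  closed_dual : IsClosed W
  convex_dual : Convex ℝ W
  /-- Strong concavity in the dual variable. -/
  strongly_concave : ∀ θ ∈ Θ, StrongConcaveOn W μ (objective f Ξ θ)

end Objective

section Algorithm

variable {d : ℕ} {Z : Type*}

/-- The inputs of the algorithm: step-size parameters, feasible sets and initial point. -/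
structure Params (d : ℕ) where
  κ : ℝ
  η : ℝ
  α : ℝ
  β : ℝ
  ν : ℕ → ℝ
  Θ : Set (Vec d)
  W : Set (Vec d)
  θ₀ : Vec d
  ω₀ : Vec d

/-- The variables `(θ_t, ω_t, p_t, d_t)` at time `t`; the dual gradient estimator `d_t` is the
field `q`, the letter `d` being the dimension. -/
structure State (d : ℕ) where
  θ : Vec d
  ω : Vec d
  p : Vec d
  q : Vec d

/-- The projected primal update computed from the state at time `t`. -/
def thetaTilde (A : Params d) (s : State d) : Vec d := proj A.Θ (s.θ - A.κ • s.p)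

/-- The projected dual update computed from the state at time `t`. -/
def omegaTilde (A : Params d) (s : State d) : Vec d := proj A.W (s.ω + A.η • s.q)

/-- Initialization with noises `up`, `uq` and data point `ξ`. The algorithm accesses gradients of
the loss only through the two oracles `gθ` and `gω`, which return their answers in an arbitrary
monad, so that the oracle calls can be counted. -/
def initialState {m : Type → Type} [Monad m] (gθ gω : Vec d → Vec d → Z → m (Vec d))
    (A : Params d) (ξ : Z) (up uq : Vec d) : m (State d) := do
  let p ← gθ A.θ₀ A.ω₀ ξ
  let q ← gω A.θ₀ A.ω₀ ξ
  pure ⟨A.θ₀, A.ω₀, p + up, q + uq⟩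

/-- The iteration from time `t` to time `t + 1` with the data point and the noises of
time `t + 1`. -/
def step {m : Type → Type} [Monad m] (gθ gω : Vec d → Vec d → Z → m (Vec d))
    (A : Params d) (t : ℕ) (ξ : Z) (up uq : Vec d) (s : State d) : m (State d) := do
  let θ := s.θ + A.ν t • (thetaTilde A s - s.θ)
  let ω := s.ω + A.ν t • (omegaTilde A s - s.ω)
  let a ← gθ θ ω ξ
  let c ← gω θ ω ξ
  let p' := (1 - A.α * A.ν t) • s.p + (A.α * A.ν t) • a
  let q' := (1 - A.β * A.ν t) • s.q + (A.β * A.ν t) • c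
  pure ⟨θ, ω, p' + up, q' + uq⟩

/-- The initialization followed by `t` iterations. The input `ζ k` collects the data point and the
primal and dual noises of time `k`. -/
def run {m : Type → Type} [Monad m] (gθ gω : Vec d → Vec d → Z → m (Vec d))
    (A : Params d) (ζ : ℕ → Z × Vec d × Vec d) : ℕ → m (State d)
  | 0 => initialState gθ gω A (ζ 0).1 (ζ 0).2.1 (ζ 0).2.2
  | t + 1 => do
    let s ← run gθ gω A ζ t
    step gθ gω A t (ζ (t + 1)).1 (ζ (t + 1)).2.1 (ζ (t + 1)).2.2 s

/-- The oracle that answers with `g` and increases a counter by one at each call. -/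
def counting (g : Vec d → Vec d → Z → Vec d) (θ ω : Vec d) (ξ : Z) : StateM ℕ (Vec d) := do
  modify (· + 1)
  pure (g θ ω ξ)

/-- The algorithm run with the exact gradients of the loss `f`, counted from zero: the state at
time `t` and the number of gradient evaluations made so far. -/
def execute (f : Vec d → Vec d → Z → ℝ) (A : Params d) (ζ : ℕ → Z × Vec d × Vec d) (t : ℕ) :
    State d × ℕ :=
  StateT.run (m := Id)
    (run (counting fun θ ω ξ => gradTheta (fun x y => f x y ξ) θ ω)
      (counting fun θ ω ξ => gradOmega (fun x y => f x y ξ) θ ω) A ζ t) 0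

/-- The state `(θ_t, ω_t, p_t, d_t)` reached at time `t`. -/
def iterate (f : Vec d → Vec d → Z → ℝ) (A : Params d) (ζ : ℕ → Z × Vec d × Vec d) (t : ℕ) :
    State d := (execute f A ζ t).1

/-- The number of gradient evaluations made by the initialization and `T` iterations. -/
def gradientComplexity (f : Vec d → Vec d → Z → ℝ) (A : Params d)
    (ζ : ℕ → Z × Vec d × Vec d) (T : ℕ) : ℕ := (execute f A ζ T).2

/-- The utility metric at the state of time `t`:
`κ⁻¹ ‖θ̃_{t+1} - θ_t‖ + ‖∇_θ F(θ_t, ω_t) - p_t‖ + L_F ‖ω_t - ω^*(θ_t)‖`. -/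
def metric (F : Vec d → Vec d → ℝ) (L_F : ℝ) (A : Params d) (s : State d) : ℝ :=
  A.κ⁻¹ * ‖thetaTilde A s - s.θ‖ + ‖gradTheta F s.θ s.ω - s.p‖
    + L_F * ‖s.ω - argmaxOn A.W (F s.θ)‖

end Algorithm

section Noise

/-- The Rényi order `α' = log(1/δ) / ((1 - β') ε) + 1`. -/
def renyiOrder (ε δ β' : ℝ) : ℝ := Real.log (1 / δ) / ((1 - β') * ε) + 1

/-- The noise variance `14 G² T α' / (n² (ε - log(1/δ) / (α' - 1)))`. -/
def noiseVariance (G : ℝ) (n T : ℕ) (ε δ β' : ℝ) : ℝ :=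
  14 * G ^ 2 * T * renyiOrder ε δ β' /
    ((n : ℝ) ^ 2 * (ε - Real.log (1 / δ) / (renyiOrder ε δ β' - 1)))

/-- The randomness of a run of the algorithm on a probability space `(S, P)`. The triples
`ζ t = (ξ_t, u_t^p, u_t^d)` are i.i.d. in `t`; within a triple the entries are independent, `ξ_t`
has law `Ξ` and both noises have law `N(0, σ² I_d)`. The index `R` of the output is uniform on
`{0, …, T - 1}` and independent of all triples. -/
structure IsRandomness {d T : ℕ} {Z S : Type*} [MeasurableSpace Z] [MeasurableSpace S]
    (P : Measure S) (Ξ : Measure Z) (σsq : ℝ) (ζ : ℕ → S → Z × Vec d × Vec d)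
    (R : S → Fin T) : Prop where
  law : ∀ t, HasLaw (ζ t)
    (Ξ.prod ((multivariateGaussian 0 (σsq • (1 : Matrix (Fin d) (Fin d) ℝ))).prod
      (multivariateGaussian 0 (σsq • (1 : Matrix (Fin d) (Fin d) ℝ))))) P
  indep : iIndepFun ζ P
  index_law : HasLaw R (uniformOn (Set.univ : Set (Fin T))) P
  index_indep : IndepFun R (fun s t => ζ t s) P

end Noise

end DPTD

end

namespace DPTD

open scoped RealInnerProductSpace Topology

/-! ### First-order inequalities on convex sets. -/

section ConvexAnalysis

variable {E : Type*} [NormedAddCommGroup E] [InnerProductSpace ℝ E] [CompleteSpace E]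
  {K : Set E} {g : E → ℝ} {g' : E → E} {a x y : E} {L m : ℝ}

/-! The argument is a Lyapunov analysis of a stochastic primal-dual method with averaged gradient
estimators. The potential is V = J(θ) + C ‖ω - ω*(θ)‖² + B (‖∇_θ F - p‖² + ‖∇_ω F - q‖²), with C =
6κL²/(ημ) and B = 3κL²/μ².

Three deterministic estimates drive it. Strong concavity makes ω* Lipschitz with constant L/μ, so J
obeys a descent inequality and decreases along the projected primal step, up to the dual gap and the
error of p (`IsSaddle.primal_step_le`). The dual step contracts the distance to ω*, up to the error
of q and the drift of ω* (`IsSaddle.dual_step_le`). The factor 1 - 3ν contracts the estimator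
errors, up to the displacement of the iterates (`IsSaddle.error_step_le`). With the weights B and C
every cost is paid by a gain, and a decrease of νκ/10 times the squared metric is left
(`potential_step_le`).

The randomness enters only through p and q. Sampling errors and Gaussian noises are centred,
independent of each other and of the past, so they add B (9ν²G² + 2dσ²) to the expected potential
(`Assumptions.lintegral_noisy_gradients_le`). This needs the stochastic gradients to be unbiased and
bounded by G, although the Lipschitz condition is available only on D and a feasible point may lie
on its boundary (`exists_pair_directions`).

Telescoping bounds the sum of ν_t E[𝔐_t²]. As ν_t² is a multiple of 1/(t+b), the sampling errors
contribute log(T+b). The choice of T keeps T d σ² below a constant (`mul_noiseVariance_le`), so the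
privacy noise contributes O(1). Dividing by T ν_T, of order √T, bounds the second moment of the
metric at a uniform index by a multiple of log(T+b)/√T. A square root gives the rate, since T is
comparable to nε/√(d log(1/δ)).

Expectations of the potential are lower Lebesgue integrals of its excess over a lower bound J₀ of J;
its integrability is then never needed. -/

lemma hasDerivAt_line {t : ℝ} {v : E} (h : HasGradientAt g a (x + t • v)) :
    HasDerivAt (fun s : ℝ => g (x + s • v)) ⟪a, v⟫ t := by
  have h1 : HasDerivAt (fun s : ℝ => x + s • v) v t := by
    simpa using ((hasDerivAt_id t).smul_const v).const_add x
  have h2 := h.hasFDerivAt.comp_hasDerivAt t h1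
  simpa [InnerProductSpace.toDual_apply_apply, Function.comp_def] using h2

/-- Descent lemma for a function whose gradient is one-sided Lipschitz on a convex set. -/
lemma le_add_inner_add_of_gradient (hK : Convex ℝ K)
    (hg : ∀ z ∈ K, HasGradientAt g (g' z) z)
    (hL : ∀ z ∈ K, ∀ w ∈ K, ⟪g' w - g' z, w - z⟫ ≤ L * ‖w - z‖ ^ 2)
    (hx : x ∈ K) (hy : y ∈ K) :
    g y ≤ g x + ⟪g' x, y - x⟫ + L / 2 * ‖y - x‖ ^ 2 := by
  set v := y - x with hv
  have hmem : ∀ t ∈ Set.Icc (0 : ℝ) 1, x + t • v ∈ K := fun t ht =>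
    hK.add_smul_sub_mem hx hy ht
  -- Along the segment, g minus its quadratic model has nonpositive derivative.
  have hder : ∀ t ∈ Set.Icc (0 : ℝ) 1,
      HasDerivAt (fun s : ℝ => g (x + s • v) - s * ⟪g' x, v⟫ - L / 2 * s ^ 2 * ‖v‖ ^ 2)
        (⟪g' (x + t • v), v⟫ - ⟪g' x, v⟫ - L * t * ‖v‖ ^ 2) t := by
    intro t ht
    have h1 := hasDerivAt_line (hg _ (hmem t ht))
    have h2 : HasDerivAt (fun s : ℝ => s * ⟪g' x, v⟫) ⟪g' x, v⟫ t := by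
      simpa using (hasDerivAt_id t).mul_const ⟪g' x, v⟫
    have h3 : HasDerivAt (fun s : ℝ => L / 2 * s ^ 2 * ‖v‖ ^ 2) (L * t * ‖v‖ ^ 2) t := by
      have := (((hasDerivAt_id t).pow 2).const_mul (L / 2)).mul_const (‖v‖ ^ 2)
      simp only [id_eq] at this
      refine this.congr_deriv ?_
      simp only [Nat.cast_ofNat, Nat.add_one_sub_one, pow_one]
      ring
    exact (h1.sub h2).sub h3
  have hanti := antitoneOn_of_deriv_nonpos (convex_Icc (0 : ℝ) 1)
    (fun t ht => (hder t ht).continuousAt.continuousWithinAt)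
    (fun t ht => (hder t (interior_subset ht)).differentiableAt.differentiableWithinAt)
    (fun t ht => by
      rw [(hder t (interior_subset ht)).deriv]
      rw [interior_Icc] at ht
      have h := hL x hx _ (hmem t ⟨ht.1.le, ht.2.le⟩)
      rw [add_sub_cancel_left, inner_smul_right, norm_smul, inner_sub_left, Real.norm_eq_abs,
        abs_of_pos ht.1] at h
      have h' : t * (⟪g' (x + t • v), v⟫ - ⟪g' x, v⟫ - L * t * ‖v‖ ^ 2) ≤ 0 := by
        nlinarith
      exact nonpos_of_mul_nonpos_right h' ht.1)
  have h := hanti (Set.left_mem_Icc.2 zero_le_one) (Set.right_mem_Icc.2 zero_le_one) zero_le_one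
  simp only [one_smul, zero_smul, add_zero] at h
  rw [show x + v = y by rw [hv]; abel] at h
  linarith

/-- Divide the strong concavity inequality on the segment by t and let t decrease to 0. -/
lemma StrongConcaveOn.le_add_inner_sub (hc : StrongConcaveOn K m g) (hg : HasGradientAt g a x)
    (hx : x ∈ K) (hy : y ∈ K) :
    g y ≤ g x + ⟪a, y - x⟫ - m / 2 * ‖y - x‖ ^ 2 := by
  set v := y - x with hv
  have hd : HasDerivAt (fun s : ℝ => g (x + s • v)) ⟪a, v⟫ 0 :=
    hasDerivAt_line (by simpa using hg)
  have h1 := hd.tendsto_slope_zero_right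
  have h2 : Filter.Tendsto (fun t : ℝ => g y - g x + (1 - t) * (m / 2 * ‖v‖ ^ 2))
      (nhdsWithin 0 (Set.Ioi 0)) (nhds (g y - g x + (1 - 0) * (m / 2 * ‖v‖ ^ 2))) := by
    apply Filter.Tendsto.mono_left _ nhdsWithin_le_nhds
    exact Continuous.tendsto (by fun_prop) _
  have h3 := le_of_tendsto_of_tendsto h2 h1 (by
    filter_upwards [Ioo_mem_nhdsGT (zero_lt_one' ℝ)] with t ht
    have h := hc.2 hx hy (sub_nonneg.2 ht.2.le) ht.1.le (sub_add_cancel 1 t)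
    have e : (1 - t) • x + t • y = x + t • v := by rw [hv]; module
    rw [e, norm_sub_rev, ← hv] at h
    simp only [smul_eq_mul] at h
    simp only [zero_add, zero_smul, add_zero, smul_eq_mul]
    rw [← div_eq_inv_mul, le_div_iff₀ ht.1]
    nlinarith)
  linarith

lemma inner_gradient_nonpos_of_isMaxOn (hK : Convex ℝ K) (hg : HasGradientAt g a x)
    (hmax : IsMaxOn g K x) (hx : x ∈ K) (hy : y ∈ K) : ⟪a, y - x⟫ ≤ 0 := by
  have := hmax.localize.hasFDerivWithinAt_nonpos hg.hasFDerivAt.hasFDerivWithinAt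
    (sub_mem_posTangentConeAt_of_segment_subset (hK.segment_subset hx hy))
  simpa [InnerProductSpace.toDual_apply_apply] using this

/-- The quadratic upper bound at any x in K puts g below g x outside the ball of radius 2‖∇g(x)‖/m,
so compactness applies even when K is unbounded. -/
lemma StrongConcaveOn.exists_isMaxOn [FiniteDimensional ℝ E] (hc : StrongConcaveOn K m g)
    (hm : 0 < m) (hK : IsClosed K) (hne : K.Nonempty)
    (hg : ∀ z ∈ K, HasGradientAt g (g' z) z) : ∃ z ∈ K, IsMaxOn g K z := by
  obtain ⟨x, hx⟩ := hne
  have hcont : ContinuousOn g K := fun z hz => (hg z hz).continuousAt.continuousWithinAt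
  refine hcont.exists_isMaxOn' hK hx ?_
  rw [Filter.eventually_inf_principal]
  filter_upwards [(isCompact_closedBall x (2 * ‖g' x‖ / m)).compl_mem_cocompact] with z hz hzK
  have h1 := StrongConcaveOn.le_add_inner_sub hc (hg x hx) hx hzK
  have h2 := real_inner_le_norm (g' x) (z - x)
  have h3 : 2 * ‖g' x‖ / m < ‖z - x‖ := by
    simpa [dist_eq_norm] using hz
  rw [div_lt_iff₀ hm] at h3
  nlinarith [norm_nonneg (z - x)]

end ConvexAnalysis

/-! ### Euclidean projection. -/

section Projection

variable {d : ℕ} {K : Set (Vec d)}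

lemma proj_spec (hne : K.Nonempty) (hc : IsClosed K) (hv : Convex ℝ K) (x : Vec d) :
    proj K x ∈ K ∧ ∀ z ∈ K, ⟪x - proj K x, z - proj K x⟫ ≤ 0 := by
  obtain ⟨y, hy, hmin⟩ := exists_norm_eq_iInf_of_complete_convex hne hc.isComplete hv x
  have hbdd : BddBelow (Set.range fun w : K => ‖x - w‖) :=
    ⟨0, by rintro _ ⟨w, rfl⟩; exact norm_nonneg _⟩
  have hspec : proj K x ∈ K ∧ ∀ z ∈ K, ‖x - proj K x‖ ≤ ‖x - z‖ := by
    refine Classical.epsilon_spec (p := fun y => y ∈ K ∧ ∀ z ∈ K, ‖x - y‖ ≤ ‖x - z‖) ⟨y, hy, ?_⟩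
    intro z hz
    rw [hmin]
    exact ciInf_le hbdd ⟨z, hz⟩
  refine ⟨hspec.1, (norm_eq_iInf_iff_real_inner_le_zero hv hspec.1).1 ?_⟩
  have : Nonempty K := ⟨⟨y, hy⟩⟩
  exact le_antisymm (le_ciInf fun w => hspec.2 w w.2) (ciInf_le hbdd ⟨_, hspec.1⟩)

lemma continuous_proj (hne : K.Nonempty) (hc : IsClosed K) (hv : Convex ℝ K) :
    Continuous (proj K) := by
  refine LipschitzWith.continuous (K := 1) (LipschitzWith.of_dist_le_mul fun x y => ?_)
  rw [NNReal.coe_one, one_mul, dist_eq_norm, dist_eq_norm]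
  obtain ⟨hx, hx'⟩ := proj_spec hne hc hv x
  obtain ⟨hy, hy'⟩ := proj_spec hne hc hv y
  set u := proj K x
  set w := proj K y
  have h1 := hx' w hy
  have h2 := hy' u hx
  -- Firm nonexpansiveness: the sum of the two variational inequalities.
  have h3 : ‖u - w‖ ^ 2 ≤ ⟪x - y, u - w⟫ := by
    have e : ⟪x - y, u - w⟫ = ‖u - w‖ ^ 2 - ⟪x - u, w - u⟫ - ⟪y - w, u - w⟫ := by
      rw [← real_inner_self_eq_norm_sq, ← neg_sub u w, inner_neg_right, sub_neg_eq_add,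
        ← inner_add_left, ← inner_sub_left]
      congr 1
      abel
    linarith
  have h4 := real_inner_le_norm (x - y) (u - w)
  by_contra! hlt
  nlinarith [norm_nonneg (x - y), norm_nonneg (u - w)]

end Projection

/-! ### The maximizer map, the primal function and one dual projection. -/

section Saddle

variable {d : ℕ}

lemma pairNorm_sq (x y : Vec d) : pairNorm x y ^ 2 = ‖x‖ ^ 2 + ‖y‖ ^ 2 :=
  Real.sq_sqrt (by positivity)

lemma pairNorm_nonneg (x y : Vec d) : 0 ≤ pairNorm x y := Real.sqrt_nonneg _

lemma norm_le_pairNorm_left (x y : Vec d) : ‖x‖ ≤ pairNorm x y :=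
  Real.le_sqrt_of_sq_le (by nlinarith [sq_nonneg ‖y‖])

lemma norm_le_pairNorm_right (x y : Vec d) : ‖y‖ ≤ pairNorm x y :=
  Real.le_sqrt_of_sq_le (by nlinarith [sq_nonneg ‖x‖])

lemma pairNorm_zero_right (x : Vec d) : pairNorm x 0 = ‖x‖ := by
  simp [pairNorm]

lemma pairNorm_zero_left (x : Vec d) : pairNorm 0 x = ‖x‖ := by
  simp [pairNorm]

/-- A smooth objective that is strongly concave in the dual variable, on closed convex sets. -/
structure IsSaddle (F : Vec d → Vec d → ℝ) (Θ W : Set (Vec d)) (L μ : ℝ) : Prop where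
  pos : 0 < μ
  le : μ ≤ L
  closed_primal : IsClosed Θ
  convex_primal : Convex ℝ Θ
  closed_dual : IsClosed W
  convex_dual : Convex ℝ W
  nonempty_dual : W.Nonempty
  grad_theta : ∀ θ ∈ Θ, ∀ ω ∈ W, HasGradientAt (fun x => F x ω) (gradTheta F θ ω) θ
  grad_omega : ∀ θ ∈ Θ, ∀ ω ∈ W, HasGradientAt (F θ) (gradOmega F θ ω) ω
  smooth : ∀ θ ∈ Θ, ∀ θ' ∈ Θ, ∀ ω ∈ W, ∀ ω' ∈ W,
    pairNorm (gradTheta F θ ω - gradTheta F θ' ω') (gradOmega F θ ω - gradOmega F θ' ω')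
      ≤ L * pairNorm (θ - θ') (ω - ω')
  strongly_concave : ∀ θ ∈ Θ, StrongConcaveOn W μ (F θ)

namespace IsSaddle

variable {F : Vec d → Vec d → ℝ} {Θ W : Set (Vec d)} {L μ : ℝ} {θ θ' ω ω' : Vec d}

lemma pos' (h : IsSaddle F Θ W L μ) : 0 < L := h.pos.trans_le h.le

lemma argmaxOn_spec (h : IsSaddle F Θ W L μ) (hθ : θ ∈ Θ) :
    argmaxOn W (F θ) ∈ W ∧ IsMaxOn (F θ) W (argmaxOn W (F θ)) := by
  obtain ⟨z, hz, hmax⟩ := StrongConcaveOn.exists_isMaxOn (h.strongly_concave θ hθ) h.pos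
    h.closed_dual h.nonempty_dual (h.grad_omega θ hθ)
  exact Classical.epsilon_spec (p := fun y => y ∈ W ∧ ∀ z ∈ W, F θ z ≤ F θ y) ⟨z, hz, hmax⟩

lemma argmaxOn_mem (h : IsSaddle F Θ W L μ) (hθ : θ ∈ Θ) : argmaxOn W (F θ) ∈ W :=
  (h.argmaxOn_spec hθ).1

lemma inner_gradOmega_argmaxOn (h : IsSaddle F Θ W L μ) (hθ : θ ∈ Θ) (hω : ω ∈ W) :
    ⟪gradOmega F θ (argmaxOn W (F θ)), ω - argmaxOn W (F θ)⟫ ≤ 0 :=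
  inner_gradient_nonpos_of_isMaxOn h.convex_dual
    (h.grad_omega θ hθ _ (h.argmaxOn_mem hθ)) (h.argmaxOn_spec hθ).2 (h.argmaxOn_mem hθ) hω

lemma le_argmaxOn_sub (h : IsSaddle F Θ W L μ) (hθ : θ ∈ Θ) (hω : ω ∈ W) :
    F θ ω ≤ F θ (argmaxOn W (F θ)) - μ / 2 * ‖ω - argmaxOn W (F θ)‖ ^ 2 := by
  have h1 := StrongConcaveOn.le_add_inner_sub (h.strongly_concave θ hθ)
    (h.grad_omega θ hθ _ (h.argmaxOn_mem hθ)) (h.argmaxOn_mem hθ) hω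
  linarith [h.inner_gradOmega_argmaxOn hθ hω]

lemma primal_eq (h : IsSaddle F Θ W L μ) (hθ : θ ∈ Θ) :
    primal F W θ = F θ (argmaxOn W (F θ)) := by
  refine IsGreatest.csSup_eq ⟨Set.mem_image_of_mem _ (h.argmaxOn_mem hθ), ?_⟩
  rintro _ ⟨z, hz, rfl⟩
  exact (h.argmaxOn_spec hθ).2 hz

lemma le_primal (h : IsSaddle F Θ W L μ) (hθ : θ ∈ Θ) (hω : ω ∈ W) : F θ ω ≤ primal F W θ := by
  rw [h.primal_eq hθ]
  exact (h.argmaxOn_spec hθ).2 hω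

/-- Compare the two maximizers u, w under F θ. Strong concavity at w and quadratic growth at u give
μ‖u - w‖² ≤ ⟪∇_ω F(θ, w), u - w⟫. Optimality of w at θ' allows subtracting ∇_ω F(θ', w), and
smoothness bounds the difference. -/
lemma mul_norm_argmaxOn_sub_le (h : IsSaddle F Θ W L μ) (hθ : θ ∈ Θ) (hθ' : θ' ∈ Θ) :
    μ * ‖argmaxOn W (F θ) - argmaxOn W (F θ')‖ ≤ L * ‖θ - θ'‖ := by
  have hm := h.argmaxOn_mem hθ
  have hm' := h.argmaxOn_mem hθ'
  have h1 := StrongConcaveOn.le_add_inner_sub (h.strongly_concave θ hθ)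
    (h.grad_omega θ hθ _ hm') hm' hm
  have h2 := h.le_argmaxOn_sub hθ hm'
  have h3 := h.inner_gradOmega_argmaxOn hθ' hm
  set u := argmaxOn W (F θ)
  set w := argmaxOn W (F θ')
  have h4 := h.smooth θ hθ θ' hθ' w hm' w hm'
  rw [sub_self, pairNorm_zero_right] at h4
  have h5 := (norm_le_pairNorm_right _ _).trans h4
  have h6 := real_inner_le_norm (gradOmega F θ w - gradOmega F θ' w) (u - w)
  rw [inner_sub_left] at h6
  rw [norm_sub_rev w u] at h2
  have h7 : μ * ‖u - w‖ ^ 2 ≤ L * ‖θ - θ'‖ * ‖u - w‖ := by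
    have := mul_le_mul_of_nonneg_right h5 (norm_nonneg (u - w))
    linarith
  rcases (norm_nonneg (u - w)).eq_or_lt with h0 | h0
  · rw [← h0, mul_zero]
    exact mul_nonneg h.pos'.le (norm_nonneg _)
  · exact le_of_mul_le_mul_right (by linarith [sq ‖u - w‖, mul_assoc μ ‖u - w‖ ‖u - w‖]) h0

/-- A descent inequality for J that does not need J to be differentiable. Freeze the dual variable
at the maximizer w of θ', use smoothness of F(·, w) and F(θ, w) ≤ J(θ), then replace w by the
maximizer of θ inside the gradient; the Lipschitz bound on the maximizers makes this replacement
cost L²/μ. -/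
lemma primal_le (h : IsSaddle F Θ W L μ) (hθ : θ ∈ Θ) (hθ' : θ' ∈ Θ) :
    primal F W θ' ≤ primal F W θ + ⟪gradTheta F θ (argmaxOn W (F θ)), θ' - θ⟫
      + (L / 2 + L ^ 2 / μ) * ‖θ' - θ‖ ^ 2 := by
  have hm := h.argmaxOn_mem hθ
  have hm' := h.argmaxOn_mem hθ'
  have h0 := h.mul_norm_argmaxOn_sub_le hθ' hθ
  have h1 := h.le_primal hθ hm'
  rw [h.primal_eq hθ']
  set u := argmaxOn W (F θ)
  set w := argmaxOn W (F θ')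
  have h2 : F θ' w ≤ F θ w + ⟪gradTheta F θ w, θ' - θ⟫ + L / 2 * ‖θ' - θ‖ ^ 2 := by
    refine le_add_inner_add_of_gradient h.convex_primal
      (fun z hz => h.grad_theta z hz w hm') (fun z hz z' hz' => ?_) hθ hθ'
    have h3 := (norm_le_pairNorm_left _ _).trans (h.smooth z' hz' z hz w hm' w hm')
    rw [sub_self, pairNorm_zero_right] at h3
    have h4 := real_inner_le_norm (gradTheta F z' w - gradTheta F z w) (z' - z)
    nlinarith [norm_nonneg (z' - z)]
  have h3 := (norm_le_pairNorm_left _ _).trans (h.smooth θ hθ θ hθ w hm' u hm)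
  rw [sub_self, pairNorm_zero_left] at h3
  have h4 := real_inner_le_norm (gradTheta F θ w - gradTheta F θ u) (θ' - θ)
  rw [inner_sub_left] at h4
  have h5 : ‖w - u‖ ≤ L / μ * ‖θ' - θ‖ := by
    rw [div_mul_eq_mul_div, le_div_iff₀ h.pos]; linarith
  have h6 : ‖gradTheta F θ w - gradTheta F θ u‖ * ‖θ' - θ‖ ≤ L ^ 2 / μ * ‖θ' - θ‖ ^ 2 := by
    calc _ ≤ (L * (L / μ * ‖θ' - θ‖)) * ‖θ' - θ‖ := by
          gcongr
          exact h3.trans (mul_le_mul_of_nonneg_left h5 h.pos'.le)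
      _ = _ := by ring
  linarith

/-- One projected ascent step with inexact gradient q. The lower smoothness bound between ω and the
projected point, strong concavity at ω and quadratic growth at the maximizer combine with the
variational inequality of the projection. -/
lemma dual_projection_le (h : IsSaddle F Θ W L μ) {η : ℝ} (hη : 0 < η)
    (hη' : 4 * (η * L ^ 2) ≤ μ) (hθ : θ ∈ Θ) (hω : ω ∈ W) (q : Vec d) :
    ‖proj W (ω + η • q) - argmaxOn W (F θ)‖ ^ 2 + 3 / 4 * ‖proj W (ω + η • q) - ω‖ ^ 2
      ≤ (1 - η * μ) * ‖ω - argmaxOn W (F θ)‖ ^ 2 + η / μ * ‖gradOmega F θ ω - q‖ ^ 2 := by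
  obtain ⟨ht, hp⟩ := proj_spec h.nonempty_dual h.closed_dual h.convex_dual (ω + η • q)
  set w := proj W (ω + η • q)
  have hm := h.argmaxOn_mem hθ
  have h1 := h.le_argmaxOn_sub hθ ht
  have h2 := StrongConcaveOn.le_add_inner_sub (h.strongly_concave θ hθ)
    (h.grad_omega θ hθ _ hω) hω hm
  set u := argmaxOn W (F θ)
  have h3 : F θ ω + ⟪gradOmega F θ ω, w - ω⟫ - L / 2 * ‖w - ω‖ ^ 2 ≤ F θ w := by
    have := le_add_inner_add_of_gradient (g := fun z => - F θ z)
      (g' := fun z => - gradOmega F θ z) (L := L) h.convex_dual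
      (fun z hz => by
        have := (h.grad_omega θ hθ z hz).hasFDerivAt.neg
        rw [hasGradientAt_iff_hasFDerivAt, map_neg]
        exact this) (fun z hz z' hz' => ?_) hω ht
    · simp only [inner_neg_left] at this
      linarith
    have h3 := (norm_le_pairNorm_right _ _).trans (h.smooth θ hθ θ hθ z hz z' hz')
    rw [sub_self, pairNorm_zero_left, norm_sub_rev z z'] at h3
    rw [neg_sub_neg]
    have h4 := real_inner_le_norm (gradOmega F θ z - gradOmega F θ z') (z' - z)
    nlinarith [norm_nonneg (z' - z)]
  have h4 := hp u hm
  have e1 : ⟪ω + η • q - w, u - w⟫ = ⟪ω - w, u - w⟫ + η * ⟪q, u - w⟫ := by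
    rw [add_sub_right_comm, inner_add_left, real_inner_smul_left]
  have e2 : ⟪ω - w, u - w⟫ = (‖w - ω‖ ^ 2 + ‖w - u‖ ^ 2 - ‖ω - u‖ ^ 2) / 2 := by
    have := norm_sub_sq_real (ω - w) (u - w)
    rw [sub_sub_sub_cancel_right, norm_sub_rev ω w, norm_sub_rev u w] at this
    linarith
  have e3 : ⟪gradOmega F θ ω, w - ω⟫ - ⟪gradOmega F θ ω, u - ω⟫
      = - ⟪gradOmega F θ ω - q, u - w⟫ - ⟪q, u - w⟫ := by
    rw [← inner_sub_right, inner_sub_left, sub_sub_sub_cancel_right, ← neg_sub u w,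
      inner_neg_right]
    ring
  have h5 := real_inner_le_norm (gradOmega F θ ω - q) (u - w)
  rw [norm_sub_rev u w] at h5
  rw [norm_sub_rev u ω] at h2
  -- Weighted so that the quadratic growth term μ/2 ‖w - u‖² absorbs the first summand exactly.
  have h6 : ‖gradOmega F θ ω - q‖ * ‖w - u‖
      ≤ μ / 2 * ‖w - u‖ ^ 2 + ‖gradOmega F θ ω - q‖ ^ 2 / (2 * μ) := by
    have : 0 ≤ (μ * ‖w - u‖ - ‖gradOmega F θ ω - q‖) ^ 2 / (2 * μ) :=
      div_nonneg (sq_nonneg _) (by linarith [h.pos])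
    have e : (μ * ‖w - u‖ - ‖gradOmega F θ ω - q‖) ^ 2 / (2 * μ)
        = μ / 2 * ‖w - u‖ ^ 2 + ‖gradOmega F θ ω - q‖ ^ 2 / (2 * μ)
          - ‖gradOmega F θ ω - q‖ * ‖w - u‖ := by
      have := h.pos.ne'
      field_simp
      ring
    linarith
  -- Leaves 1 - ηL ≥ 3/4 in front of ‖w - ω‖².
  have hηL : 4 * (η * L) ≤ 1 := by
    have h7 : 4 * (η * L) * L ≤ 1 * L := by nlinarith [h.le]
    exact le_of_mul_le_mul_right h7 h.pos'
  have h8 : η / μ * ‖gradOmega F θ ω - q‖ ^ 2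
      = 2 * η * (‖gradOmega F θ ω - q‖ ^ 2 / (2 * μ)) := by
    have := h.pos.ne'
    field_simp
  have h9 : ⟪gradOmega F θ ω, w - ω⟫ - ⟪gradOmega F θ ω, u - ω⟫ + μ / 2 * ‖ω - u‖ ^ 2
      - L / 2 * ‖w - ω‖ ^ 2 + μ / 2 * ‖w - u‖ ^ 2 ≤ 0 := by linarith
  rw [e3] at h9
  have h10 : - ⟪q, u - w⟫ + μ / 2 * ‖ω - u‖ ^ 2 - L / 2 * ‖w - ω‖ ^ 2
      - ‖gradOmega F θ ω - q‖ ^ 2 / (2 * μ) ≤ 0 := by linarith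
  have h11 := mul_le_mul_of_nonneg_left h10 (by linarith : 0 ≤ 2 * η)
  rw [e1, e2] at h4
  have h12 : η * L * ‖w - ω‖ ^ 2 ≤ 1 / 4 * ‖w - ω‖ ^ 2 := by gcongr; linarith
  rw [h8]
  linarith

end IsSaddle

end Saddle

/-! ### Young's inequality with a free parameter. -/

section Scalar

lemma sq_add_le_of_pos {s x y : ℝ} (hs : 0 < s) :
    (x + y) ^ 2 ≤ (1 + s) * x ^ 2 + (1 + 1 / s) * y ^ 2 := by
  have h : 0 ≤ (s * x - y) ^ 2 / s := div_nonneg (sq_nonneg _) hs.le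
  have e : (s * x - y) ^ 2 / s = s * x ^ 2 + 1 / s * y ^ 2 - 2 * (x * y) := by
    field_simp
    ring
  nlinarith

lemma norm_add_sq_le_of_pos {E : Type*} [SeminormedAddCommGroup E] {s : ℝ} (hs : 0 < s) (x y : E) :
    ‖x + y‖ ^ 2 ≤ (1 + s) * ‖x‖ ^ 2 + (1 + 1 / s) * ‖y‖ ^ 2 :=
  (pow_le_pow_left₀ (norm_nonneg _) (norm_add_le x y) 2).trans (sq_add_le_of_pos hs)

end Scalar

/-! ### Deterministic one-step estimates. -/

section Steps

variable {d : ℕ} {F : Vec d → Vec d → ℝ} {Θ W : Set (Vec d)} {L μ κ η ν : ℝ} {θ ω : Vec d}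

namespace IsSaddle

/-- Testing the projection inequality at θ gives ⟪p, t - θ⟫ ≤ -‖t - θ‖²/κ. The gap between p and the
gradient of F at the maximizer splits into the dual gap and the error of p. -/
lemma primal_step_le (h : IsSaddle F Θ W L μ) (hκ : 0 < κ) (hκL : 36 * (κ * L ^ 2) ≤ μ)
    (hν : 0 < ν) (hν' : ν ≤ 1 / 4) (hθ : θ ∈ Θ) (hω : ω ∈ W) (p : Vec d) :
    primal F W (θ + ν • (proj Θ (θ - κ • p) - θ)) ≤ primal F W θ
      - 7 / 10 * ν / κ * ‖proj Θ (θ - κ • p) - θ‖ ^ 2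
      + 2 * ν * κ * (L ^ 2 * ‖ω - argmaxOn W (F θ)‖ ^ 2 + ‖gradTheta F θ ω - p‖ ^ 2) := by
  obtain ⟨ht, hp⟩ := proj_spec ⟨θ, hθ⟩ h.closed_primal h.convex_primal (θ - κ • p)
  set t := proj Θ (θ - κ • p)
  have hm := h.argmaxOn_mem hθ
  have hmem : θ + ν • (t - θ) ∈ Θ :=
    h.convex_primal.add_smul_sub_mem hθ ht ⟨hν.le, by linarith⟩
  have h1 := h.primal_le hθ hmem
  set u := argmaxOn W (F θ)
  rw [add_sub_cancel_left, real_inner_smul_right, norm_smul, Real.norm_eq_abs, abs_of_pos hν] at h1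
  have h2 := hp θ hθ
  have e2 : ⟪θ - κ • p - t, θ - t⟫ = ‖t - θ‖ ^ 2 + κ * ⟪p, t - θ⟫ := by
    rw [sub_right_comm, inner_sub_left, real_inner_self_eq_norm_sq, norm_sub_rev,
      real_inner_smul_left, ← neg_sub t θ, inner_neg_right]
    ring
  rw [e2] at h2
  have h3 := (norm_le_pairNorm_left _ _).trans (h.smooth θ hθ θ hθ u hm ω hω)
  rw [sub_self, pairNorm_zero_left, norm_sub_rev u ω] at h3
  have h4 : ‖gradTheta F θ u - p‖ ≤ L * ‖ω - u‖ + ‖gradTheta F θ ω - p‖ := by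
    calc _ = ‖(gradTheta F θ u - gradTheta F θ ω) + (gradTheta F θ ω - p)‖ := by
          rw [sub_add_sub_cancel]
      _ ≤ _ := (norm_add_le _ _).trans (by linarith)
  have h5 := real_inner_le_norm (gradTheta F θ u - p) (t - θ)
  rw [inner_sub_left] at h5
  set x := ‖t - θ‖
  set y := ‖ω - u‖
  set e := ‖gradTheta F θ ω - p‖
  have hx : 0 ≤ x := norm_nonneg _
  have h6 : ⟪p, t - θ⟫ ≤ - (x ^ 2 / κ) := by
    have : κ * ⟪p, t - θ⟫ ≤ κ * (- (x ^ 2 / κ)) := by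
      rw [mul_neg, mul_div_cancel₀ _ hκ.ne']; linarith
    exact le_of_mul_le_mul_left this hκ
  -- Young spends 1/4 of the gain x²/κ; the curvature term below spends 1/24, and 17/24 ≥ 7/10
  -- remains.
  have h7 : (L * y + e) * x ≤ 1 / 4 * (x ^ 2 / κ) + 2 * κ * (L ^ 2 * y ^ 2 + e ^ 2) := by
    have h8 : 0 ≤ (x - 2 * κ * (L * y + e)) ^ 2 / (4 * κ) :=
      div_nonneg (sq_nonneg _) (by linarith)
    have h9 : (x - 2 * κ * (L * y + e)) ^ 2 / (4 * κ)
        = 1 / 4 * (x ^ 2 / κ) - (L * y + e) * x + κ * (L * y + e) ^ 2 := by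
      field_simp
      ring
    have h10 : κ * (L * y + e) ^ 2 ≤ κ * (2 * (L ^ 2 * y ^ 2 + e ^ 2)) := by
      gcongr
      nlinarith [sq_nonneg (L * y - e)]
    linarith
  have h8 : (L / 2 + L ^ 2 / μ) * (ν * x) ^ 2 ≤ 1 / 24 * ν * (x ^ 2 / κ) := by
    have h9 : L / 2 + L ^ 2 / μ ≤ 3 / 2 * (L ^ 2 / μ) := by
      have : L ≤ L ^ 2 / μ := by
        rw [le_div_iff₀ h.pos]; nlinarith [h.le, h.pos']
      linarith
    have h10 : L ^ 2 / μ ≤ 1 / (36 * κ) := by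
      rw [div_le_div_iff₀ h.pos (by linarith)]; linarith
    have h11 : L / 2 + L ^ 2 / μ ≤ 1 / (24 * κ) := by
      calc _ ≤ 3 / 2 * (1 / (36 * κ)) := by linarith
        _ = _ := by field_simp; norm_num
    calc _ ≤ 1 / (24 * κ) * (ν * x) ^ 2 := by gcongr
      _ = ν * (1 / 24 * ν * (x ^ 2 / κ)) := by field_simp
      _ ≤ 1 * (1 / 24 * ν * (x ^ 2 / κ)) := by gcongr; linarith
      _ = _ := one_mul _
  have h9 : ⟪gradTheta F θ u, t - θ⟫
      ≤ - (3 / 4) * (x ^ 2 / κ) + 2 * κ * (L ^ 2 * y ^ 2 + e ^ 2) := by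
    have := mul_le_mul_of_nonneg_right h4 hx
    linarith
  have h10 := mul_le_mul_of_nonneg_left h9 hν.le
  have h11 : 0 ≤ ν * (x ^ 2 / κ) := by positivity
  have h12 : 7 / 10 * ν / κ * x ^ 2 = 7 / 10 * (ν * (x ^ 2 / κ)) := by ring
  rw [h12]
  linarith

/-- The step is a convex combination of ω and its projected update, so `dual_projection_le`
contracts the squared distance to the old maximizer by 1 - νημ. Half of this contraction is spent on
moving to the new maximizer. -/
lemma dual_step_le (h : IsSaddle F Θ W L μ) (hη : 0 < η) (hη' : 4 * (η * L ^ 2) ≤ μ)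
    (hημ : η * μ ≤ 1 / 4) (hν : 0 < ν) (hν' : ν ≤ 1 / 4) (hθ : θ ∈ Θ) (hω : ω ∈ W) {t : Vec d}
    (ht : t ∈ Θ) (q : Vec d) :
    ‖ω + ν • (proj W (ω + η • q) - ω) - argmaxOn W (F (θ + ν • (t - θ)))‖ ^ 2
      ≤ (1 - ν * (η * μ) / 2) * ‖ω - argmaxOn W (F θ)‖ ^ 2
        + 11 / 10 * ν * (η / μ) * ‖gradOmega F θ ω - q‖ ^ 2
        - 3 / 2 * ν * ‖proj W (ω + η • q) - ω‖ ^ 2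
        + 3 * ν * (L ^ 2 / (η * μ ^ 3)) * ‖t - θ‖ ^ 2 := by
  have h1 := h.dual_projection_le hη hη' hθ hω q
  have hmem : θ + ν • (t - θ) ∈ Θ :=
    h.convex_primal.add_smul_sub_mem hθ ht ⟨hν.le, by linarith⟩
  have h2 := h.mul_norm_argmaxOn_sub_le hθ hmem
  rw [sub_add_cancel_left, norm_neg, norm_smul, Real.norm_eq_abs, abs_of_pos hν] at h2
  set w := proj W (ω + η • q)
  set u := argmaxOn W (F θ)
  set u' := argmaxOn W (F (θ + ν • (t - θ)))
  have hμ := h.pos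
  have h3 : ‖u - u'‖ ≤ L / μ * (ν * ‖t - θ‖) := by
    rw [div_mul_eq_mul_div, le_div_iff₀ hμ]; linarith
  have h4 : ‖ω + ν • (w - ω) - u‖ ^ 2
      = (1 - ν) * ‖ω - u‖ ^ 2 + ν * ‖w - u‖ ^ 2 - ν * (1 - ν) * ‖w - ω‖ ^ 2 := by
    have e1 : ω + ν • (w - ω) - u = (ω - u) + ν • (w - ω) := by abel
    have e2 : w - u = (ω - u) + (w - ω) := by abel
    rw [e1, e2, norm_add_sq_real, norm_add_sq_real, norm_smul, real_inner_smul_right, mul_pow,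
      Real.norm_eq_abs, sq_abs]
    ring
  -- The Young parameter: half the contraction rate, so that (1 + s)(1 - 2s) ≤ 1 - s.
  have hs : 0 < ν * (η * μ) / 2 := by positivity
  have h5 := norm_add_sq_le_of_pos hs (ω + ν • (w - ω) - u) (u - u')
  rw [sub_add_sub_cancel] at h5
  set s := ν * (η * μ) / 2 with hsdef
  set Y := ‖ω - u‖ ^ 2
  set g := ‖gradOmega F θ ω - q‖ ^ 2
  set z := ‖w - ω‖ ^ 2
  set x := ‖t - θ‖
  have hY : 0 ≤ Y := sq_nonneg _
  have hz : 0 ≤ z := sq_nonneg _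
  have hg : 0 ≤ η / μ * g := by positivity
  have hs' : s ≤ 1 / 32 := by
    have := mul_le_mul hν' hημ (by positivity) (by norm_num : (0 : ℝ) ≤ 1 / 4)
    linarith
  have h6 : ‖ω + ν • (w - ω) - u‖ ^ 2
      ≤ (1 - 2 * s) * Y + ν * (η / μ * g) - 3 / 2 * ν * z := by
    rw [h4]
    have := mul_le_mul_of_nonneg_left h1 hν.le
    have h7 : 0 ≤ (1 / 4 - ν) * (ν * z) := mul_nonneg (by linarith) (by positivity)
    have e : 2 * s = ν * (η * μ) := by rw [hsdef]; ring
    rw [e]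
    linarith
  have h7 : (1 + s) * ‖ω + ν • (w - ω) - u‖ ^ 2
      ≤ (1 - s) * Y + 11 / 10 * (ν * (η / μ * g)) - 3 / 2 * ν * z := by
    have := mul_le_mul_of_nonneg_left h6 (by linarith : 0 ≤ 1 + s)
    have h8 : 0 ≤ s ^ 2 * Y := by positivity
    have h9 : 0 ≤ s * (ν * z) := by positivity
    have h10 : 0 ≤ (1 / 10 - s) * (ν * (η / μ * g)) :=
      mul_nonneg (by linarith) (by positivity)
    linarith
  have h8 : (1 + 1 / s) * ‖u - u'‖ ^ 2 ≤ 3 * ν * (L ^ 2 / (η * μ ^ 3)) * x ^ 2 := by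
    have h9 : (1 + 1 / s) * ν ^ 2 ≤ 3 * ν / (η * μ) := by
      have e : (1 + 1 / s) * ν ^ 2 = (ν * (η * μ) + 2) * ν / (η * μ) := by
        rw [hsdef]
        field_simp
      rw [e]
      gcongr
      linarith
    calc _ ≤ (1 + 1 / s) * (L / μ * (ν * x)) ^ 2 := by gcongr
      _ = (1 + 1 / s) * ν ^ 2 * ((L / μ) ^ 2 * x ^ 2) := by ring
      _ ≤ 3 * ν / (η * μ) * ((L / μ) ^ 2 * x ^ 2) := by gcongr
      _ = _ := by field_simp
  linarith

/-- The deterministic part of the new estimator errors: the old errors shrink by 1 - 3ν, while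
smoothness controls the change of the gradients. Young with parameter 3ν, together with (1 - 3ν)²(1
+ 3ν) ≤ 1 - 3ν, keeps the drift of order ν although the displacement squared is of order ν². -/
lemma error_step_le (h : IsSaddle F Θ W L μ) (hν : 0 < ν) (hν' : ν ≤ 1 / 4) (hθ : θ ∈ Θ)
    (hω : ω ∈ W) {t w : Vec d} (ht : t ∈ Θ) (hw : w ∈ W) (p q : Vec d) :
    ‖(1 - 3 * ν) • (p - gradTheta F (θ + ν • (t - θ)) (ω + ν • (w - ω)))‖ ^ 2
      + ‖(1 - 3 * ν) • (q - gradOmega F (θ + ν • (t - θ)) (ω + ν • (w - ω)))‖ ^ 2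
      ≤ (1 - 3 * ν) * (‖gradTheta F θ ω - p‖ ^ 2 + ‖gradOmega F θ ω - q‖ ^ 2)
        + ν / 3 * L ^ 2 * (‖t - θ‖ ^ 2 + ‖w - ω‖ ^ 2) := by
  have hmem : θ + ν • (t - θ) ∈ Θ :=
    h.convex_primal.add_smul_sub_mem hθ ht ⟨hν.le, by linarith⟩
  have hmem' : ω + ν • (w - ω) ∈ W :=
    h.convex_dual.add_smul_sub_mem hω hw ⟨hν.le, by linarith⟩
  have h1 := h.smooth θ hθ _ hmem ω hω _ hmem'
  set a := gradTheta F (θ + ν • (t - θ)) (ω + ν • (w - ω))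
  set c := gradOmega F (θ + ν • (t - θ)) (ω + ν • (w - ω))
  set a₀ := gradTheta F θ ω
  set c₀ := gradOmega F θ ω
  have h2 : ‖a₀ - a‖ ^ 2 + ‖c₀ - c‖ ^ 2
      ≤ L ^ 2 * ν ^ 2 * (‖t - θ‖ ^ 2 + ‖w - ω‖ ^ 2) := by
    rw [← pairNorm_sq]
    refine (pow_le_pow_left₀ (pairNorm_nonneg _ _) h1 2).trans (le_of_eq ?_)
    rw [mul_pow, pairNorm_sq, sub_add_cancel_left, sub_add_cancel_left, norm_neg, norm_neg,
      norm_smul, norm_smul, Real.norm_eq_abs, abs_of_pos hν]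
    ring
  have h3 : ∀ x y z : Vec d, ‖(1 - 3 * ν) • (x - z)‖ ^ 2 ≤
      (1 - 3 * ν) ^ 2 * ((1 + 3 * ν) * ‖y - x‖ ^ 2 + (1 + 1 / (3 * ν)) * ‖y - z‖ ^ 2) := by
    intro x y z
    have := norm_add_sq_le_of_pos (by linarith : 0 < 3 * ν) (x - y) (y - z)
    rw [sub_add_sub_cancel, norm_sub_rev x y] at this
    rw [norm_smul, mul_pow, Real.norm_eq_abs, sq_abs]
    gcongr
  have h4 := h3 p a₀ a
  have h5 := h3 q c₀ c
  set e := ‖a₀ - p‖ ^ 2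
  set g := ‖c₀ - q‖ ^ 2
  set Q := ‖t - θ‖ ^ 2 + ‖w - ω‖ ^ 2
  have hQ : 0 ≤ Q := by positivity
  have he : 0 ≤ e + g := by positivity
  have h6 : (1 - 3 * ν) ^ 2 * (1 + 3 * ν) ≤ 1 - 3 * ν := by
    have : 0 ≤ (1 - 3 * ν) * (9 * ν ^ 2) := mul_nonneg (by linarith) (by positivity)
    linarith
  have h7 : (1 - 3 * ν) ^ 2 * (1 + 1 / (3 * ν)) * (L ^ 2 * ν ^ 2 * Q) ≤ ν / 3 * L ^ 2 * Q := by
    have e1 : (1 - 3 * ν) ^ 2 * (1 + 1 / (3 * ν)) * (L ^ 2 * ν ^ 2 * Q)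
        = ((1 - 3 * ν) ^ 2 * (1 + 3 * ν)) * (ν / 3 * L ^ 2 * Q) := by
      field_simp
      ring
    rw [e1]
    refine mul_le_of_le_one_left (by positivity) (by linarith)
  have h8 := mul_le_mul_of_nonneg_left h2
    (by positivity : 0 ≤ (1 - 3 * ν) ^ 2 * (1 + 1 / (3 * ν)))
  have h9 := mul_le_mul_of_nonneg_right h6 he
  linarith

end IsSaddle

end Steps

/-! ### The potential and its deterministic decrease. -/

section Potential

variable {d : ℕ}

/-- The next primal iterate. -/
noncomputable def nextTheta (A : Params d) (ν : ℝ) (s : State d) : Vec d := s.θ + ν • (thetaTilde A s - s.θ)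

/-- The next dual iterate. -/
noncomputable def nextOmega (A : Params d) (ν : ℝ) (s : State d) : Vec d := s.ω + ν • (omegaTilde A s - s.ω)

/-- The part of the potential that depends only on the iterates. -/
noncomputable def iteratePotential (F : Vec d → Vec d → ℝ) (L μ : ℝ) (A : Params d) (θ ω : Vec d) : ℝ :=
  primal F A.W θ + 6 * A.κ * L ^ 2 / (A.η * μ) * ‖ω - argmaxOn A.W (F θ)‖ ^ 2

/-- The weight of the gradient estimation errors in the potential. -/
noncomputable def errorWeight (L μ κ : ℝ) : ℝ := 3 * κ * L ^ 2 / μ ^ 2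

/-- The potential decreased in expectation by an iteration. -/
noncomputable def potential (F : Vec d → Vec d → ℝ) (L μ : ℝ) (A : Params d) (s : State d) : ℝ :=
  iteratePotential F L μ A s.θ s.ω
    + errorWeight L μ A.κ * (‖gradTheta F s.θ s.ω - s.p‖ ^ 2 + ‖gradOmega F s.θ s.ω - s.q‖ ^ 2)

/-- The step sizes are small enough. -/
structure AdmissibleSteps (L μ κ η : ℝ) : Prop where
  kappa_pos : 0 < κ
  eta_pos : 0 < η
  kappa_le : 9 * (κ * L ^ 2) ≤ η * μ ^ 2
  eta_le : 4 * (η * L ^ 2) ≤ μ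

lemma add_add_sq_le (a b c : ℝ) : (a + b + c) ^ 2 ≤ 3 * (a ^ 2 + b ^ 2 + c ^ 2) := by
  nlinarith [sq_nonneg (a - b), sq_nonneg (a - c), sq_nonneg (b - c)]

/-- The estimator errors appear here before sampling and privacy noise are added. C makes the dual
contraction worth 3κL², more than the 2κL² charged by the primal step; B is such that C·η/μ = 2B, so
the estimator gain 3B exceeds the dual charge 2.2B. -/
lemma potential_step_le {F : Vec d → Vec d → ℝ} {A : Params d} {L μ ν : ℝ}
    (h : IsSaddle F A.Θ A.W L μ) (hA : AdmissibleSteps L μ A.κ A.η) (hν : 0 < ν)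
    (hν' : ν ≤ 1 / 4) {s : State d} (hθ : s.θ ∈ A.Θ) (hω : s.ω ∈ A.W) :
    iteratePotential F L μ A (nextTheta A ν s) (nextOmega A ν s)
      + errorWeight L μ A.κ *
        (‖(1 - 3 * ν) • (s.p - gradTheta F (nextTheta A ν s) (nextOmega A ν s))‖ ^ 2
        + ‖(1 - 3 * ν) • (s.q - gradOmega F (nextTheta A ν s) (nextOmega A ν s))‖ ^ 2)
      + ν * A.κ / 10 * metric F L A s ^ 2 ≤ potential F L μ A s := by
  obtain ⟨hκ, hη, hκ', hη'⟩ := hA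
  have hμ := h.pos
  have hL := h.pos'
  have hμL : μ ^ 2 ≤ L ^ 2 := pow_le_pow_left₀ hμ.le h.le 2
  have hημ : A.η * μ ≤ 1 / 4 := by
    have : 4 * (A.η * μ) * μ ≤ 1 * μ := by nlinarith
    have := le_of_mul_le_mul_right this hμ
    linarith
  have hκL : 36 * (A.κ * L ^ 2) ≤ μ := by nlinarith
  have ht : thetaTilde A s ∈ A.Θ := (proj_spec ⟨_, hθ⟩ h.closed_primal h.convex_primal _).1
  have hw : omegaTilde A s ∈ A.W := (proj_spec ⟨_, hω⟩ h.closed_dual h.convex_dual _).1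
  have h1 := h.primal_step_le hκ hκL hν hν' hθ hω s.p
  have h2 := h.dual_step_le hη hη' hημ hν hν' hθ hω ht s.q
  have h3 := h.error_step_le hν hν' hθ hω ht hw s.p s.q
  simp only [potential, iteratePotential, nextTheta, nextOmega, metric]
  rw [← thetaTilde] at h1
  rw [← omegaTilde] at h2
  set κ := A.κ
  set η := A.η
  set B := errorWeight L μ κ with hB
  have hB0 : 0 < B := by rw [hB, errorWeight]; positivity
  set C := 6 * κ * L ^ 2 / (η * μ) with hC
  have hC0 : 0 < C := by positivity
  have h2' := mul_le_mul_of_nonneg_left h2 hC0.le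
  have h3' := mul_le_mul_of_nonneg_left h3 hB0.le
  set x := ‖thetaTilde A s - s.θ‖
  set z := ‖omegaTilde A s - s.ω‖
  set y := ‖s.ω - argmaxOn A.W (F s.θ)‖
  set e := ‖gradTheta F s.θ s.ω - s.p‖
  set g := ‖gradOmega F s.θ s.ω - s.q‖
  have c1 : C * (η * μ) = 6 * κ * L ^ 2 := by rw [hC]; field_simp
  have c2 : C * (η / μ) = 2 * B := by rw [hC, hB, errorWeight]; field_simp; norm_num
  have hsq : 81 * (κ ^ 2 * L ^ 4) ≤ η ^ 2 * μ ^ 4 := by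
    have := pow_le_pow_left₀ (by positivity) hκ' 2
    linarith
  have c3 : C * (L ^ 2 / (η * μ ^ 3)) ≤ 2 / 27 * (1 / κ) := by
    have e1 : C * (L ^ 2 / (η * μ ^ 3)) = 6 * (κ ^ 2 * L ^ 4) / (η ^ 2 * μ ^ 4) * (1 / κ) := by
      rw [hC]; field_simp
    rw [e1]
    refine mul_le_mul_of_nonneg_right ?_ (by positivity)
    rw [div_le_div_iff₀ (by positivity) (by norm_num)]
    linarith
  have c4 : B * L ^ 2 ≤ 3 / 81 * (1 / κ) := by
    have e1 : B * L ^ 2 = 3 * (κ ^ 2 * L ^ 4) / μ ^ 2 * (1 / κ) := by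
      rw [hB, errorWeight]; field_simp
    rw [e1]
    refine mul_le_mul_of_nonneg_right ?_ (by positivity)
    rw [div_le_div_iff₀ (by positivity) (by norm_num)]
    have : η ^ 2 * μ ^ 4 ≤ μ ^ 2 := by
      have : (η * μ) ^ 2 ≤ 1 := pow_le_one₀ (by positivity) (by linarith)
      nlinarith [sq_nonneg μ]
    linarith
  have c5 : B * L ^ 2 ≤ 3 / 2 * C := by
    have e1 : B * L ^ 2 = 1 / 2 * C / μ * (η * L ^ 2) := by
      rw [hB, hC, errorWeight]; field_simp; norm_num
    have e2 : 1 / 2 * C = 1 / 2 * C / μ * μ := by field_simp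
    have := mul_le_mul_of_nonneg_left hη' (by positivity : 0 ≤ 1 / 2 * C / μ)
    linarith
  have c6 : 3 * κ ≤ B := by
    rw [hB, errorWeight, le_div_iff₀ (by positivity)]
    have := mul_le_mul_of_nonneg_left hμL hκ.le
    linarith
  -- After multiplication by νκ/10, each squared part of the metric is charged 3/10.
  have hM : (κ⁻¹ * x + e + L * y) ^ 2 ≤ 3 * (x ^ 2 / κ ^ 2 + e ^ 2 + L ^ 2 * y ^ 2) := by
    have e1 : x ^ 2 / κ ^ 2 = (κ⁻¹ * x) ^ 2 := by field_simp
    rw [e1, ← mul_pow]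
    exact add_add_sq_le _ _ _
  clear_value x y z e g B C κ η
  have hM' := mul_le_mul_of_nonneg_left hM (by positivity : 0 ≤ ν * κ / 10)
  have e5 : ν * κ / 10 * (3 * (x ^ 2 / κ ^ 2 + e ^ 2 + L ^ 2 * y ^ 2))
      = 3 / 10 * (ν * (1 / κ * x ^ 2)) + 3 / 10 * (ν * (κ * e ^ 2))
        + 3 / 10 * (ν * (κ * L ^ 2 * y ^ 2)) := by
    field_simp
  rw [e5] at hM'
  have i1 := mul_le_mul_of_nonneg_right c3 (by positivity : 0 ≤ ν * x ^ 2)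
  have i2 := mul_le_mul_of_nonneg_right c4 (by positivity : 0 ≤ ν * x ^ 2)
  have i3 := mul_le_mul_of_nonneg_right c5 (by positivity : 0 ≤ ν * z ^ 2)
  have i4 := mul_le_mul_of_nonneg_right c6 (by positivity : 0 ≤ ν * e ^ 2)
  have i5 : 0 ≤ B * (ν * g ^ 2) := by positivity
  have i6 : 0 ≤ ν * (κ * L ^ 2 * y ^ 2) := by positivity
  have i7 : 0 ≤ ν * (κ * e ^ 2) := by positivity
  have i8 : 0 ≤ ν * (1 / κ * x ^ 2) := by positivity
  have i9 : 0 ≤ C * (ν * z ^ 2) := by positivity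
  have e1 : C * ((1 - ν * (η * μ) / 2) * y ^ 2 + 11 / 10 * ν * (η / μ) * g ^ 2
      - 3 / 2 * ν * z ^ 2 + 3 * ν * (L ^ 2 / (η * μ ^ 3)) * x ^ 2)
      = C * y ^ 2 - (C * (η * μ)) * ν * y ^ 2 / 2 + 11 / 10 * (C * (η / μ)) * (ν * g ^ 2)
        - 3 / 2 * (C * (ν * z ^ 2)) + 3 * (C * (L ^ 2 / (η * μ ^ 3)) * (ν * x ^ 2)) := by ring
  rw [e1, c1, c2] at h2'
  have e2 : 7 / 10 * ν / κ * x ^ 2 = 7 / 10 * (ν * (1 / κ * x ^ 2)) := by field_simp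
  rw [e2] at h1
  -- The balance per unit of ν: for x²/κ, 7/10 against 2/9 + 1/81 + 3/10; for κL²y², 3 against 2 +
  -- 3/10; for e², 3B ≥ 9κ against (2 + 3/10)κ; for g², 3B against 2.2B; for z², 3C/2 against C/2.
  linarith

end Potential

/-! ### Directional derivatives at boundary points of a convex set. -/

section Directional

variable {X : Type*} [NormedAddCommGroup X] [NormedSpace ℝ X]

/-- From a point of a convex set with nonempty interior, every direction is a multiple of the
difference of two directions pointing into the set. -/
lemma exists_pair_directions {D : Set X} (hD : Convex ℝ D) (hi : (interior D).Nonempty)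
    {z : X} (hz : z ∈ D) (v : X) :
    ∃ (a : X) (s : ℝ), 0 < s ∧ ∀ t ∈ Set.Icc (0 : ℝ) 1,
      z + t • a ∈ D ∧ z + t • (a + s • v) ∈ D := by
  obtain ⟨c, hc⟩ := hi
  have hcont : Continuous fun r : ℝ => c + r • v := by fun_prop
  have h1 : ∀ᶠ r in 𝓝[>] (0 : ℝ), c + r • v ∈ interior D := by
    apply Filter.Eventually.filter_mono nhdsWithin_le_nhds
    exact hcont.continuousAt.eventually_mem (isOpen_interior.mem_nhds (by simpa using hc))
  obtain ⟨s, hs, hs0⟩ := (h1.and self_mem_nhdsWithin).exists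
  -- Aim at the interior point c and at its perturbation c + s v, which is still interior for small
  -- s.
  refine ⟨c - z, s, hs0, fun t ht => ⟨hD.add_smul_sub_mem hz (interior_subset hc) ht, ?_⟩⟩
  rw [sub_add_eq_add_sub]
  exact hD.add_smul_sub_mem hz (interior_subset hs) ht

/-- Recovers the derivative along v without evaluating h on the ray from z along v, which may leave
the domain of the Lipschitz condition. -/
lemma tendsto_diff_quotient_pair {h : X → ℝ} {h' : X →L[ℝ] ℝ} {z : X} (hh : HasFDerivAt h h' z)
    (a v : X) (s : ℝ) :
    Filter.Tendsto (fun n : ℕ => ((n : ℝ) + 1) *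
      (h (z + (1 / ((n : ℝ) + 1)) • (a + s • v)) - h (z + (1 / ((n : ℝ) + 1)) • a)))
      Filter.atTop (𝓝 (s * h' v)) := by
  have key : ∀ w : X, Filter.Tendsto (fun n : ℕ => ((n : ℝ) + 1) *
      (h (z + (1 / ((n : ℝ) + 1)) • w) - h z)) Filter.atTop (𝓝 (h' w)) := by
    intro w
    have h1 : HasDerivAt (fun t : ℝ => z + t • w) w 0 := by
      simpa using ((hasDerivAt_id (0 : ℝ)).smul_const w).const_add z
    have h2 : HasDerivAt (fun t : ℝ => h (z + t • w)) (h' w) 0 := by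
      have hh0 : HasFDerivAt h h' (z + (0 : ℝ) • w) := by simpa using hh
      exact hh0.comp_hasDerivAt 0 h1
    have h3 := h2.tendsto_slope_zero_right.comp
      (tendsto_nhdsWithin_iff.2 ⟨tendsto_one_div_add_atTop_nhds_zero_nat (𝕜 := ℝ),
        Filter.Eventually.of_forall fun n => Set.mem_Ioi.2 Nat.one_div_pos_of_nat⟩)
    refine h3.congr fun n => ?_
    simp
  have := (key (a + s • v)).sub (key a)
  rw [map_add, add_sub_cancel_left, map_smul, smul_eq_mul] at this
  refine this.congr fun n => ?_
  ring

end Directional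

/-! ### Partial gradients and the joint derivative. -/

section Gradients

variable {d : ℕ}

lemma hasGradientAt_gradTheta {g : Vec d → Vec d → ℝ} {θ ω : Vec d}
    (h : DifferentiableAt ℝ (fun z : Vec d × Vec d => g z.1 z.2) (θ, ω)) :
    HasGradientAt (fun x => g x ω) (gradTheta g θ ω) θ := by
  have h1 : DifferentiableAt ℝ (fun x => g x ω) θ :=
    DifferentiableAt.comp (g := fun z : Vec d × Vec d => g z.1 z.2) (f := fun x => (x, ω)) θ h
      (by fun_prop)
  exact h1.hasGradientAt

lemma hasGradientAt_gradOmega {g : Vec d → Vec d → ℝ} {θ ω : Vec d}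
    (h : DifferentiableAt ℝ (fun z : Vec d × Vec d => g z.1 z.2) (θ, ω)) :
    HasGradientAt (g θ) (gradOmega g θ ω) ω := by
  have h1 : DifferentiableAt ℝ (fun y => g θ y) ω :=
    DifferentiableAt.comp (g := fun z : Vec d × Vec d => g z.1 z.2) (f := fun y => (θ, y)) ω h
      (by fun_prop)
  exact h1.hasGradientAt

lemma fderiv_apply_eq_inner {g : Vec d → Vec d → ℝ} {θ ω : Vec d}
    (h : DifferentiableAt ℝ (fun z : Vec d × Vec d => g z.1 z.2) (θ, ω)) (v : Vec d × Vec d) :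
    fderiv ℝ (fun z : Vec d × Vec d => g z.1 z.2) (θ, ω) v
      = ⟪gradTheta g θ ω, v.1⟫ + ⟪gradOmega g θ ω, v.2⟫ := by
  set g' := fderiv ℝ (fun z : Vec d × Vec d => g z.1 z.2) (θ, ω)
  have h0 : HasFDerivAt (fun z : Vec d × Vec d => g z.1 z.2) g' (θ, ω) := h.hasFDerivAt
  have h1 : HasFDerivAt (fun x => g x ω) (g'.comp (ContinuousLinearMap.inl ℝ (Vec d) (Vec d))) θ :=
    HasFDerivAt.comp (g := fun z : Vec d × Vec d => g z.1 z.2) (f := fun x => (x, ω)) θ h0 (hasFDerivAt_prodMk_left θ ω)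
  have h2 : HasFDerivAt (g θ) (g'.comp (ContinuousLinearMap.inr ℝ (Vec d) (Vec d))) ω :=
    HasFDerivAt.comp (g := fun z : Vec d × Vec d => g z.1 z.2) ω h0 (hasFDerivAt_prodMk_right θ ω)
  have e1 := congrArg (fun l => l v.1) (h1.unique (hasGradientAt_gradTheta h).hasFDerivAt)
  have e2 := congrArg (fun l => l v.2) (h2.unique (hasGradientAt_gradOmega h).hasFDerivAt)
  simp only [InnerProductSpace.toDual_apply_apply, ContinuousLinearMap.comp_apply,
    ContinuousLinearMap.inl_apply, ContinuousLinearMap.inr_apply] at e1 e2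
  rw [← e1, ← e2, ← map_add]
  simp

end Gradients

/-! ### Bounded and unbiased stochastic gradients. -/

section Objective

variable {d : ℕ} {Z : Type*} [MeasurableSpace Z] {f : Vec d → Vec d → Z → ℝ} {Ξ : Measure Z}
  {Θ W : Set (Vec d)} {D : Set (Vec d × Vec d)} {L G μ : ℝ} {θ ω : Vec d}

/-- Stochastic gradient in the primal variable. -/
noncomputable def lossGradTheta (f : Vec d → Vec d → Z → ℝ) (θ ω : Vec d) (ξ : Z) : Vec d :=
  gradTheta (fun x y => f x y ξ) θ ω

/-- Stochastic gradient in the dual variable. -/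
noncomputable def lossGradOmega (f : Vec d → Vec d → Z → ℝ) (θ ω : Vec d) (ξ : Z) : Vec d :=
  gradOmega (fun x y => f x y ξ) θ ω

namespace Assumptions

lemma isSaddle (H : Assumptions f Ξ Θ W D L G μ) (hμ : 0 < μ) (hL : μ ≤ L) (hW : W.Nonempty) :
    IsSaddle (objective f Ξ) Θ W L μ where
  pos := hμ
  le := hL
  closed_primal := H.closed_primal
  convex_primal := H.convex_primal
  closed_dual := H.closed_dual
  convex_dual := H.convex_dual
  nonempty_dual := hW
  grad_theta θ hθ ω hω := hasGradientAt_gradTheta (H.differentiable_objective θ hθ ω hω)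
  grad_omega θ hθ ω hω := hasGradientAt_gradOmega (H.differentiable_objective θ hθ ω hω)
  smooth := H.smooth
  strongly_concave := H.strongly_concave

/-- A bound uniform in ξ and n: it passes to the limit to bound the gradients, and it is the
dominating constant in `integral_fderiv_loss`. -/
lemma diff_quotient_le (H : Assumptions f Ξ Θ W D L G μ) {a v : Vec d × Vec d} {s : ℝ}
    (hs : 0 < s) {z : Vec d × Vec d} (ξ : Z)
    (ha : ∀ t ∈ Set.Icc (0 : ℝ) 1, z + t • a ∈ D ∧ z + t • (a + s • v) ∈ D) (n : ℕ) :
    |((n : ℝ) + 1) * (f (z + (1 / ((n : ℝ) + 1)) • (a + s • v)).1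
        (z + (1 / ((n : ℝ) + 1)) • (a + s • v)).2 ξ
      - f (z + (1 / ((n : ℝ) + 1)) • a).1 (z + (1 / ((n : ℝ) + 1)) • a).2 ξ)|
      ≤ s * (G * pairNorm v.1 v.2) := by
  have hn : (0 : ℝ) < (n : ℝ) + 1 := by positivity
  have hmem : 1 / ((n : ℝ) + 1) ∈ Set.Icc (0 : ℝ) 1 :=
    ⟨by positivity, by rw [div_le_one hn]; linarith [(Nat.cast_nonneg n : (0 : ℝ) ≤ n)]⟩
  obtain ⟨h1, h2⟩ := ha _ hmem
  have h3 := H.lipschitz ξ _ h2 _ h1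
  have e : pairNorm
      ((z + (1 / ((n : ℝ) + 1)) • (a + s • v)).1 - (z + (1 / ((n : ℝ) + 1)) • a).1)
      ((z + (1 / ((n : ℝ) + 1)) • (a + s • v)).2 - (z + (1 / ((n : ℝ) + 1)) • a).2)
      = s / ((n : ℝ) + 1) * pairNorm v.1 v.2 := by
    have e1 : (z + (1 / ((n : ℝ) + 1)) • (a + s • v)) - (z + (1 / ((n : ℝ) + 1)) • a)
        = (s / ((n : ℝ) + 1)) • v := by
      rw [add_sub_add_left_eq_sub, ← smul_sub, add_sub_cancel_left, smul_smul]
      congr 1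
      ring
    rw [← Prod.fst_sub, ← Prod.snd_sub, e1, pairNorm, pairNorm, Prod.smul_fst, Prod.smul_snd,
      norm_smul, norm_smul, mul_pow, mul_pow, ← mul_add, Real.sqrt_mul (sq_nonneg _),
      Real.sqrt_sq (norm_nonneg _), Real.norm_eq_abs, abs_of_pos (by positivity)]
  rw [e] at h3
  rw [abs_mul, abs_of_pos hn]
  calc _ ≤ ((n : ℝ) + 1) * (G * (s / ((n : ℝ) + 1) * pairNorm v.1 v.2)) := by gcongr
    _ = _ := by field_simp

lemma pairNorm_lossGrad_le (H : Assumptions f Ξ Θ W D L G μ) (hG : 0 ≤ G) (hθ : θ ∈ Θ)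
    (hω : ω ∈ W) (ξ : Z) : pairNorm (lossGradTheta f θ ω ξ) (lossGradOmega f θ ω ξ) ≤ G := by
  set gθ := lossGradTheta f θ ω ξ with hgθ
  set gω := lossGradOmega f θ ω ξ with hgω
  -- The direction is the stochastic gradient itself, so the limit reads s‖∇f‖² ≤ s G‖∇f‖.
  obtain ⟨a, s, hs, ha⟩ := exists_pair_directions H.convex_dom H.interior_dom
    (H.subset_dom (Set.mk_mem_prod hθ hω)) (gθ, gω)
  have hd := H.differentiable_loss θ hθ ω hω ξ
  have h1 := (tendsto_diff_quotient_pair hd.hasFDerivAt a (gθ, gω) s).abs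
  have h2 := le_of_tendsto h1 (Filter.Eventually.of_forall fun n => H.diff_quotient_le hs ξ ha n)
  rw [fderiv_apply_eq_inner (g := fun x y => f x y ξ) hd, ← lossGradTheta, ← lossGradOmega,
    ← hgθ, ← hgω] at h2
  simp only [real_inner_self_eq_norm_sq] at h2
  rw [← pairNorm_sq, abs_of_nonneg (by positivity)] at h2
  have h3 := le_of_mul_le_mul_left h2 hs
  by_contra! hlt
  nlinarith

lemma norm_sq_lossGrad_le (H : Assumptions f Ξ Θ W D L G μ) (hG : 0 ≤ G) (hθ : θ ∈ Θ)
    (hω : ω ∈ W) (ξ : Z) : ‖lossGradTheta f θ ω ξ‖ ^ 2 + ‖lossGradOmega f θ ω ξ‖ ^ 2 ≤ G ^ 2 := by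
  rw [← pairNorm_sq]
  exact pow_le_pow_left₀ (pairNorm_nonneg _ _) (H.pairNorm_lossGrad_le hG hθ hω ξ) 2

/-- Unbiasedness, by dominated convergence: both base points of each quotient lie in D, where the
quotients of F are the integrals of those of f. -/
lemma integral_fderiv_loss [IsProbabilityMeasure Ξ] (H : Assumptions f Ξ Θ W D L G μ)
    (hθ : θ ∈ Θ) (hω : ω ∈ W) (v : Vec d × Vec d) :
    ∫ ξ, (⟪lossGradTheta f θ ω ξ, v.1⟫ + ⟪lossGradOmega f θ ω ξ, v.2⟫) ∂Ξ
      = ⟪gradTheta (objective f Ξ) θ ω, v.1⟫ + ⟪gradOmega (objective f Ξ) θ ω, v.2⟫ := by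
  obtain ⟨a, s, hs, ha⟩ := exists_pair_directions H.convex_dom H.interior_dom
    (H.subset_dom (Set.mk_mem_prod hθ hω)) v
  have hmem : ∀ n : ℕ, 1 / ((n : ℝ) + 1) ∈ Set.Icc (0 : ℝ) 1 := fun n =>
    ⟨by positivity, by
      rw [div_le_one (by positivity)]; linarith [(Nat.cast_nonneg n : (0 : ℝ) ≤ n)]⟩
  have h1 := tendsto_diff_quotient_pair (H.differentiable_objective θ hθ ω hω).hasFDerivAt a v s
  have h2 : ∀ ξ, Filter.Tendsto (fun n : ℕ => ((n : ℝ) + 1) *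
      (f ((θ, ω) + (1 / ((n : ℝ) + 1)) • (a + s • v)).1
        ((θ, ω) + (1 / ((n : ℝ) + 1)) • (a + s • v)).2 ξ
      - f ((θ, ω) + (1 / ((n : ℝ) + 1)) • a).1 ((θ, ω) + (1 / ((n : ℝ) + 1)) • a).2 ξ))
      Filter.atTop
      (𝓝 (s * (⟪lossGradTheta f θ ω ξ, v.1⟫ + ⟪lossGradOmega f θ ω ξ, v.2⟫))) := fun ξ => by
    have hd := H.differentiable_loss θ hθ ω hω ξ
    have := tendsto_diff_quotient_pair hd.hasFDerivAt a v s
    rwa [fderiv_apply_eq_inner (g := fun x y => f x y ξ) hd] at this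
  have h3 := tendsto_integral_of_dominated_convergence (μ := Ξ)
    (fun _ => s * (G * pairNorm v.1 v.2))
    (fun n => (((H.integrable_loss _ (ha _ (hmem n)).2).sub
      (H.integrable_loss _ (ha _ (hmem n)).1)).const_mul ((n : ℝ) + 1)).aestronglyMeasurable)
    (integrable_const _)
    (fun n => Filter.Eventually.of_forall fun ξ => H.diff_quotient_le hs ξ ha n)
    (Filter.Eventually.of_forall h2)
  have h4 := tendsto_nhds_unique (h3.congr fun n => ?_) h1
  · rw [integral_const_mul, fderiv_apply_eq_inner (H.differentiable_objective θ hθ ω hω)] at h4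
    exact mul_left_cancel₀ hs.ne' h4
  · simp only [objective]
    rw [integral_const_mul]
    exact congrArg _ (integral_sub (H.integrable_loss _ (ha _ (hmem n)).2)
      (H.integrable_loss _ (ha _ (hmem n)).1))

end Assumptions

end Objective

/-! ### Measurability and moments of the stochastic gradients. -/

section Measurability

variable {d : ℕ}

/-- In orthonormal coordinates the gradient is a limit of measurable difference quotients; the
indicator removes the points where differentiability is not known. -/
lemma measurable_indicator_gradient {Q : Type*} [MeasurableSpace Q] {M : Set Q}
    (hM : MeasurableSet M) {g : Q → Vec d → ℝ} {x : Q → Vec d}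
    (hg : Measurable fun p : Q × Vec d => g p.1 p.2) (hx : Measurable x)
    (hd : ∀ q ∈ M, DifferentiableAt ℝ (g q) (x q)) :
    Measurable (M.indicator fun q => gradient (g q) (x q)) := by
  set e := EuclideanSpace.basisFun (Fin d) ℝ
  refine measurable_of_tendsto_metrizable (f := fun (n : ℕ) => M.indicator fun q =>
    ∑ i, (((n : ℝ) + 1) * (g q (x q + (1 / ((n : ℝ) + 1)) • (0 + (1 : ℝ) • e i))
      - g q (x q + (1 / ((n : ℝ) + 1)) • 0))) • e i) (fun n => ?_) (tendsto_pi_nhds.2 fun q => ?_)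
  · refine Measurable.indicator ?_ hM
    refine Finset.measurable_sum _ fun i _ => ?_
    refine Measurable.smul_const (Measurable.const_mul (Measurable.sub ?_ ?_) _) _
    · exact hg.comp (measurable_id.prodMk (hx.add_const _))
    · exact hg.comp (measurable_id.prodMk (hx.add_const _))
  · by_cases hq : q ∈ M
    · simp only [Set.indicator_of_mem hq]
      rw [← e.sum_repr' (gradient (g q) (x q))]
      refine tendsto_finsetSum _ fun i _ => Filter.Tendsto.smul_const ?_ _
      have h := tendsto_diff_quotient_pair (hd q hq).hasGradientAt.hasFDerivAt 0 (e i) 1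
      rw [one_mul, InnerProductSpace.toDual_apply_apply, real_inner_comm] at h
      exact h
    · simp only [Set.indicator_of_notMem hq]
      exact tendsto_const_nhds

variable {Z : Type*} [MeasurableSpace Z] {f : Vec d → Vec d → Z → ℝ} {Ξ : Measure Z}
  {Θ W : Set (Vec d)} {D : Set (Vec d × Vec d)} {L G μ : ℝ} {θ ω : Vec d}

namespace Assumptions

lemma measurableSet_prod (H : Assumptions f Ξ Θ W D L G μ) : MeasurableSet (Θ ×ˢ W) :=
  H.closed_primal.measurableSet.prod H.closed_dual.measurableSet

lemma measurable_lossGradTheta (H : Assumptions f Ξ Θ W D L G μ) :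
    Measurable (((Θ ×ˢ W) ×ˢ (Set.univ : Set Z)).indicator
      fun q => lossGradTheta f q.1.1 q.1.2 q.2) := by
  refine measurable_indicator_gradient (H.measurableSet_prod.prod MeasurableSet.univ)
    (g := fun q x => f x q.1.2 q.2) (x := fun q => q.1.1) ?_ (by fun_prop) fun q hq => ?_
  · exact H.measurable_loss.comp (g := fun q : (Vec d × Vec d) × Z => f q.1.1 q.1.2 q.2)
      (f := fun p : ((Vec d × Vec d) × Z) × Vec d => ((p.2, p.1.1.2), p.1.2)) (by fun_prop)
  · exact (hasGradientAt_gradTheta (g := fun x y => f x y q.2)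
      (H.differentiable_loss _ hq.1.1 _ hq.1.2 q.2)).differentiableAt

lemma measurable_lossGradOmega (H : Assumptions f Ξ Θ W D L G μ) :
    Measurable (((Θ ×ˢ W) ×ˢ (Set.univ : Set Z)).indicator
      fun q => lossGradOmega f q.1.1 q.1.2 q.2) := by
  refine measurable_indicator_gradient (H.measurableSet_prod.prod MeasurableSet.univ)
    (g := fun q y => f q.1.1 y q.2) (x := fun q => q.1.2) ?_ (by fun_prop) fun q hq => ?_
  · exact H.measurable_loss.comp (g := fun q : (Vec d × Vec d) × Z => f q.1.1 q.1.2 q.2)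
      (f := fun p : ((Vec d × Vec d) × Z) × Vec d => ((p.1.1.1, p.2), p.1.2)) (by fun_prop)
  · exact (hasGradientAt_gradOmega (g := fun x y => f x y q.2)
      (H.differentiable_loss _ hq.1.1 _ hq.1.2 q.2)).differentiableAt

lemma measurable_lossGradTheta_right (H : Assumptions f Ξ Θ W D L G μ) (hθ : θ ∈ Θ) (hω : ω ∈ W) :
    Measurable (lossGradTheta f θ ω) := by
  have h := H.measurable_lossGradTheta.comp
    (measurable_const.prodMk measurable_id : Measurable fun ξ : Z => ((θ, ω), ξ))
  convert h using 1
  funext ξ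
  symm
  exact Set.indicator_of_mem (s := (Θ ×ˢ W) ×ˢ (Set.univ : Set Z))
    ⟨⟨hθ, hω⟩, Set.mem_univ ξ⟩ _

lemma measurable_lossGradOmega_right (H : Assumptions f Ξ Θ W D L G μ) (hθ : θ ∈ Θ) (hω : ω ∈ W) :
    Measurable (lossGradOmega f θ ω) := by
  have h := H.measurable_lossGradOmega.comp
    (measurable_const.prodMk measurable_id : Measurable fun ξ : Z => ((θ, ω), ξ))
  convert h using 1
  funext ξ
  symm
  exact Set.indicator_of_mem (s := (Θ ×ˢ W) ×ˢ (Set.univ : Set Z))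
    ⟨⟨hθ, hω⟩, Set.mem_univ ξ⟩ _

lemma norm_lossGradTheta_le (H : Assumptions f Ξ Θ W D L G μ) (hG : 0 ≤ G) (hθ : θ ∈ Θ)
    (hω : ω ∈ W) (ξ : Z) : ‖lossGradTheta f θ ω ξ‖ ≤ G :=
  (norm_le_pairNorm_left _ _).trans (H.pairNorm_lossGrad_le hG hθ hω ξ)

lemma norm_lossGradOmega_le (H : Assumptions f Ξ Θ W D L G μ) (hG : 0 ≤ G) (hθ : θ ∈ Θ)
    (hω : ω ∈ W) (ξ : Z) : ‖lossGradOmega f θ ω ξ‖ ≤ G :=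
  (norm_le_pairNorm_right _ _).trans (H.pairNorm_lossGrad_le hG hθ hω ξ)

variable [IsProbabilityMeasure Ξ]

lemma memLp_lossGradTheta (H : Assumptions f Ξ Θ W D L G μ) (hG : 0 ≤ G) (hθ : θ ∈ Θ)
    (hω : ω ∈ W) : MemLp (lossGradTheta f θ ω) 2 Ξ :=
  MemLp.of_bound (H.measurable_lossGradTheta_right hθ hω).aestronglyMeasurable G
    (Filter.Eventually.of_forall fun ξ => H.norm_lossGradTheta_le hG hθ hω ξ)

lemma memLp_lossGradOmega (H : Assumptions f Ξ Θ W D L G μ) (hG : 0 ≤ G) (hθ : θ ∈ Θ)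
    (hω : ω ∈ W) : MemLp (lossGradOmega f θ ω) 2 Ξ :=
  MemLp.of_bound (H.measurable_lossGradOmega_right hθ hω).aestronglyMeasurable G
    (Filter.Eventually.of_forall fun ξ => H.norm_lossGradOmega_le hG hθ hω ξ)

lemma integral_lossGradTheta (H : Assumptions f Ξ Θ W D L G μ) (hG : 0 ≤ G) (hθ : θ ∈ Θ)
    (hω : ω ∈ W) : ∫ ξ, lossGradTheta f θ ω ξ ∂Ξ = gradTheta (objective f Ξ) θ ω := by
  have hi := (H.memLp_lossGradTheta hG hθ hω).integrable one_le_two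
  refine ext_inner_right ℝ fun v => ?_
  have h := H.integral_fderiv_loss hθ hω (v, 0)
  simp only [inner_zero_right, add_zero] at h
  rw [← h, real_inner_comm, ← integral_inner hi]
  simp only [real_inner_comm]

lemma integral_lossGradOmega (H : Assumptions f Ξ Θ W D L G μ) (hG : 0 ≤ G) (hθ : θ ∈ Θ)
    (hω : ω ∈ W) : ∫ ξ, lossGradOmega f θ ω ξ ∂Ξ = gradOmega (objective f Ξ) θ ω := by
  have hi := (H.memLp_lossGradOmega hG hθ hω).integrable one_le_two
  refine ext_inner_right ℝ fun v => ?_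
  have h := H.integral_fderiv_loss hθ hω (0, v)
  simp only [inner_zero_right, zero_add] at h
  rw [← h, real_inner_comm, ← integral_inner hi]
  simp only [real_inner_comm]

end Assumptions

end Measurability

/-! ### Second moments of centred perturbations. -/

section SecondMoment

variable {d : ℕ} {Ω : Type*} [MeasurableSpace Ω] {P : Measure Ω}

lemma integrable_norm_sq_of_memLp {Y : Ω → Vec d} (hY : MemLp Y 2 P) :
    Integrable (fun x => ‖Y x‖ ^ 2) P :=
  (memLp_two_iff_integrable_sq_norm hY.1).1 hY

variable [IsProbabilityMeasure P]

lemma integral_norm_add_sq {Y : Ω → Vec d} (hY : MemLp Y 2 P) (h0 : ∫ x, Y x ∂P = 0) (a : Vec d) :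
    ∫ x, ‖a + Y x‖ ^ 2 ∂P = ‖a‖ ^ 2 + ∫ x, ‖Y x‖ ^ 2 ∂P := by
  have hi := hY.integrable one_le_two
  have h1 : Integrable (fun x => 2 * ⟪a, Y x⟫) P := (hi.const_inner a).const_mul 2
  simp_rw [norm_add_sq_real]
  have h2 : Integrable (fun x => ‖a‖ ^ 2 + 2 * ⟪a, Y x⟫) P := (integrable_const _).add h1
  rw [integral_add h2 (integrable_norm_sq_of_memLp hY),
    integral_add (integrable_const _) h1, integral_const_mul, integral_inner hi, h0]
  simp

lemma lintegral_norm_add_sq {Y : Ω → Vec d} (hY : MemLp Y 2 P) (h0 : ∫ x, Y x ∂P = 0)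
    (a : Vec d) : ∫⁻ x, ENNReal.ofReal (‖a + Y x‖ ^ 2) ∂P
      = ENNReal.ofReal (‖a‖ ^ 2 + ∫ x, ‖Y x‖ ^ 2 ∂P) := by
  rw [← integral_norm_add_sq hY h0, ofReal_integral_eq_lintegral_ofReal]
  · exact integrable_norm_sq_of_memLp ((memLp_const a).add hY)
  · exact Filter.Eventually.of_forall fun x => sq_nonneg _

lemma integral_norm_sub_sq_le {Y : Ω → Vec d} (hY : MemLp Y 2 P) {m : Vec d}
    (hm : ∫ x, Y x ∂P = m) : ∫ x, ‖Y x - m‖ ^ 2 ∂P ≤ ∫ x, ‖Y x‖ ^ 2 ∂P := by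
  have h1 : MemLp (fun x => Y x - m) 2 P := hY.sub (memLp_const m)
  have h2 := integral_norm_add_sq h1 (by
    rw [integral_sub (hY.integrable one_le_two) (integrable_const m), hm]; simp) m
  simp only [add_sub_cancel] at h2
  rw [h2]
  linarith [sq_nonneg ‖m‖]

end SecondMoment

/-! ### Moments of the privacy noise. -/

section Gaussian

variable {d : ℕ}

/-- The law `N(0, v I_d)` of the injected noise. -/
noncomputable abbrev noiseLaw (d : ℕ) (v : ℝ) : Measure (Vec d) :=
  multivariateGaussian 0 (v • (1 : Matrix (Fin d) (Fin d) ℝ))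

lemma memLp_id_noiseLaw (v : ℝ) : MemLp (fun x => x) 2 (noiseLaw d v) :=
  IsGaussian.memLp_two_id

lemma integral_norm_sq_noiseLaw {v : ℝ} (hv : 0 ≤ v) :
    ∫ x, ‖x‖ ^ 2 ∂(noiseLaw d v) = d * v := by
  have hS : (v • (1 : Matrix (Fin d) (Fin d) ℝ)).PosSemidef := Matrix.PosSemidef.one.smul hv
  have hmem : ∀ i : Fin d, MemLp (fun x : Vec d => x i) 2 (noiseLaw d v) := fun i =>
    (EuclideanSpace.proj i : Vec d →L[ℝ] ℝ).comp_memLp' (memLp_id_noiseLaw v)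
  have hi : ∀ i : Fin d, ∫ x : Vec d, x i ^ 2 ∂(noiseLaw d v) = v := fun i => by
    have h0 : ∫ x : Vec d, x i ∂(noiseLaw d v) = 0 := by
      have := ContinuousLinearMap.integral_comp_comm (EuclideanSpace.proj i : Vec d →L[ℝ] ℝ)
        ((memLp_id_noiseLaw (d := d) v).integrable one_le_two)
      simpa using this
    have h1 := variance_eval_multivariateGaussian (μ := 0) hS i
    rw [variance_of_integral_eq_zero (hmem i).1.aemeasurable h0] at h1
    simpa using h1
  simp_rw [EuclideanSpace.real_norm_sq_eq]
  rw [integral_finsetSum _ fun i _ => (hmem i).integrable_sq]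
  simp [hi]

end Gaussian

/-! ### Second moments of independent sums. -/

section ProductMoment

variable {d : ℕ} {Ω Ω' : Type*} [MeasurableSpace Ω] [MeasurableSpace Ω'] {P : Measure Ω}
  {P' : Measure Ω'} [IsProbabilityMeasure P] [IsProbabilityMeasure P']

lemma lintegral_prod_norm_add_add_sq {Y : Ω → Vec d} {U : Ω' → Vec d} (hY : MemLp Y 2 P)
    (hY0 : ∫ x, Y x ∂P = 0) (hU : MemLp U 2 P') (hU0 : ∫ x, U x ∂P' = 0)
    (hYm : Measurable Y) (hUm : Measurable U) (a : Vec d) :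
    ∫⁻ h, ENNReal.ofReal (‖a + Y h.1 + U h.2‖ ^ 2) ∂(P.prod P')
      = ENNReal.ofReal (‖a‖ ^ 2 + ∫ x, ‖Y x‖ ^ 2 ∂P + ∫ x, ‖U x‖ ^ 2 ∂P') := by
  have hm : Measurable fun h : Ω × Ω' => ENNReal.ofReal (‖a + Y h.1 + U h.2‖ ^ 2) := by fun_prop
  rw [lintegral_prod _ hm.aemeasurable]
  have h0 : 0 ≤ ∫ x, ‖U x‖ ^ 2 ∂P' := integral_nonneg fun x => sq_nonneg _
  have h1 : 0 ≤ ∫ x, ‖Y x‖ ^ 2 ∂P := integral_nonneg fun x => sq_nonneg _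
  simp_rw [lintegral_norm_add_sq hU hU0, ENNReal.ofReal_add (sq_nonneg _) h0]
  rw [lintegral_add_right _ measurable_const, lintegral_norm_add_sq hY hY0, lintegral_const,
    measure_univ, mul_one, ← ENNReal.ofReal_add (by positivity) h0]

end ProductMoment

/-! ### Expected estimator errors after one sampling step. -/

section NoisyGradient

variable {d : ℕ} {Z : Type*} [MeasurableSpace Z] {f : Vec d → Vec d → Z → ℝ} {Ξ : Measure Z}
  [IsProbabilityMeasure Ξ] {Θ W : Set (Vec d)} {D : Set (Vec d × Vec d)} {L G μ v : ℝ}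
  {θ ω : Vec d}

/-- The law of the randomness used at one time step. -/
noncomputable abbrev stepLaw (Ξ : Measure Z) (d : ℕ) (v : ℝ) : Measure (Z × Vec d × Vec d) :=
  Ξ.prod ((noiseLaw d v).prod (noiseLaw d v))

lemma lintegral_norm_add_smul_add_fst {Y : Z → Vec d} (hY : MemLp Y 2 Ξ) (hYm : Measurable Y)
    (hv : 0 ≤ v) (a : Vec d) (s : ℝ) :
    ∫⁻ h, ENNReal.ofReal (‖a + s • (Y h.1 - ∫ ξ, Y ξ ∂Ξ) + h.2.1‖ ^ 2) ∂(stepLaw Ξ d v)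
      ≤ ENNReal.ofReal (‖a‖ ^ 2 + s ^ 2 * ∫ ξ, ‖Y ξ‖ ^ 2 ∂Ξ + d * v) ∧
    ∫⁻ h, ENNReal.ofReal (‖a + s • (Y h.1 - ∫ ξ, Y ξ ∂Ξ) + h.2.2‖ ^ 2) ∂(stepLaw Ξ d v)
      ≤ ENNReal.ofReal (‖a‖ ^ 2 + s ^ 2 * ∫ ξ, ‖Y ξ‖ ^ 2 ∂Ξ + d * v) := by
  set m := ∫ ξ, Y ξ ∂Ξ with hm
  have hYm2 : MemLp (fun ξ => s • (Y ξ - m)) 2 Ξ := (hY.sub (memLp_const m)).const_smul s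
  have hY0 : ∫ ξ, s • (Y ξ - m) ∂Ξ = 0 := by
    rw [integral_smul, integral_sub (hY.integrable one_le_two) (integrable_const m), ← hm]
    simp
  have h1 : ∫ ξ, ‖s • (Y ξ - m)‖ ^ 2 ∂Ξ ≤ s ^ 2 * ∫ ξ, ‖Y ξ‖ ^ 2 ∂Ξ := by
    simp_rw [norm_smul, mul_pow, Real.norm_eq_abs, sq_abs]
    rw [integral_const_mul]
    exact mul_le_mul_of_nonneg_left (integral_norm_sub_sq_le hY hm.symm) (sq_nonneg s)
  have hU := memLp_id_noiseLaw (d := d) v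
  have e0 : ∫ x, x ∂(noiseLaw d v) = 0 := integral_id_multivariateGaussian
  have p1 := measurePreserving_fst (μ := noiseLaw d v) (ν := noiseLaw d v)
  have p2 := measurePreserving_snd (μ := noiseLaw d v) (ν := noiseLaw d v)
  have aux : ∀ {X : Vec d × Vec d → Vec d},
      MeasurePreserving X ((noiseLaw d v).prod (noiseLaw d v)) (noiseLaw d v) →
      ∫⁻ h, ENNReal.ofReal (‖a + s • (Y h.1 - m) + X h.2‖ ^ 2) ∂(stepLaw Ξ d v)
        ≤ ENNReal.ofReal (‖a‖ ^ 2 + s ^ 2 * ∫ ξ, ‖Y ξ‖ ^ 2 ∂Ξ + d * v) := by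
    intro X hX
    have e1 : ∫ x, X x ∂((noiseLaw d v).prod (noiseLaw d v)) = 0 := by
      have := integral_map (f := fun x : Vec d => x) (hX.measurable.aemeasurable (μ := (noiseLaw d v).prod (noiseLaw d v)))
        (by fun_prop)
      rw [← this, hX.map_eq, e0]
    have e2 : ∫ x, ‖X x‖ ^ 2 ∂((noiseLaw d v).prod (noiseLaw d v)) = d * v := by
      have := integral_map (f := fun x : Vec d => ‖x‖ ^ 2) (hX.measurable.aemeasurable (μ := (noiseLaw d v).prod (noiseLaw d v)))
        (by fun_prop)
      rw [← this, hX.map_eq, integral_norm_sq_noiseLaw hv]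
    have h2 := lintegral_prod_norm_add_add_sq hYm2 hY0
      (hU.comp_measurePreserving hX) e1 ((hYm.sub_const m).const_smul s) hX.measurable a
    simp only [Function.comp_def] at h2
    rw [h2, e2]
    gcongr
  exact ⟨aux p1, aux p2⟩

/-- Cross terms vanish by independence and centring. The pair of gradients is bounded jointly, so
sampling costs G² once while the Gaussian noise costs dv for each estimator. The constant c carries
the part of the potential already fixed before sampling. -/
lemma Assumptions.lintegral_noisy_gradients_le (H : Assumptions f Ξ Θ W D L G μ) (hG : 0 ≤ G)
    (hθ : θ ∈ Θ) (hω : ω ∈ W) (hv : 0 ≤ v) {c B : ℝ} (hc : 0 ≤ c) (hB : 0 ≤ B) (a b : Vec d)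
    (s : ℝ) :
    ∫⁻ h, ENNReal.ofReal (c + B *
      (‖a + s • (lossGradTheta f θ ω h.1 - gradTheta (objective f Ξ) θ ω) + h.2.1‖ ^ 2
      + ‖b + s • (lossGradOmega f θ ω h.1 - gradOmega (objective f Ξ) θ ω) + h.2.2‖ ^ 2))
      ∂(stepLaw Ξ d v)
      ≤ ENNReal.ofReal (c + B * (‖a‖ ^ 2 + ‖b‖ ^ 2 + s ^ 2 * G ^ 2 + 2 * (d * v))) := by
  have hm1 := H.measurable_lossGradTheta_right hθ hω
  have hm2 := H.measurable_lossGradOmega_right hθ hω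
  have hp1 := H.memLp_lossGradTheta hG hθ hω
  have hp2 := H.memLp_lossGradOmega hG hθ hω
  have h1 := (lintegral_norm_add_smul_add_fst hp1 hm1 hv a s).1
  have h2 := (lintegral_norm_add_smul_add_fst hp2 hm2 hv b s).2
  rw [H.integral_lossGradTheta hG hθ hω] at h1
  rw [H.integral_lossGradOmega hG hθ hω] at h2
  have h3 : ∫ ξ, ‖lossGradTheta f θ ω ξ‖ ^ 2 ∂Ξ + ∫ ξ, ‖lossGradOmega f θ ω ξ‖ ^ 2 ∂Ξ
      ≤ G ^ 2 := by
    rw [← integral_add (integrable_norm_sq_of_memLp hp1) (integrable_norm_sq_of_memLp hp2)]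
    calc _ ≤ ∫ _, G ^ 2 ∂Ξ := integral_mono
          ((integrable_norm_sq_of_memLp hp1).add (integrable_norm_sq_of_memLp hp2))
          (integrable_const _) (fun ξ => H.norm_sq_lossGrad_le hG hθ hω ξ)
      _ = _ := by simp
  have n1 : 0 ≤ ∫ ξ, ‖lossGradTheta f θ ω ξ‖ ^ 2 ∂Ξ := integral_nonneg fun x => sq_nonneg _
  have n2 : 0 ≤ ∫ ξ, ‖lossGradOmega f θ ω ξ‖ ^ 2 ∂Ξ := integral_nonneg fun x => sq_nonneg _
  simp_rw [fun x y : Vec d => ENNReal.ofReal_add hc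
      (mul_nonneg hB (add_nonneg (sq_nonneg ‖x‖) (sq_nonneg ‖y‖))),
    ENNReal.ofReal_mul hB, fun x y : Vec d => ENNReal.ofReal_add (sq_nonneg ‖x‖) (sq_nonneg ‖y‖)]
  rw [lintegral_add_left measurable_const, lintegral_const, measure_univ, mul_one,
    lintegral_const_mul' _ _ ENNReal.ofReal_ne_top, lintegral_add_left (by fun_prop)]
  have hdv : 0 ≤ (d : ℝ) * v := by positivity
  calc _ ≤ ENNReal.ofReal c + ENNReal.ofReal B * (ENNReal.ofReal _ + ENNReal.ofReal _) := by
        gcongr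
    _ = ENNReal.ofReal (c + B * ((‖a‖ ^ 2 + s ^ 2 * ∫ ξ, ‖lossGradTheta f θ ω ξ‖ ^ 2 ∂Ξ + d * v)
        + (‖b‖ ^ 2 + s ^ 2 * ∫ ξ, ‖lossGradOmega f θ ω ξ‖ ^ 2 ∂Ξ + d * v))) := by
        rw [← ENNReal.ofReal_add (by positivity) (by positivity), ← ENNReal.ofReal_mul hB,
          ← ENNReal.ofReal_add hc (by positivity)]
    _ ≤ _ := by
        apply ENNReal.ofReal_le_ofReal
        have := mul_le_mul_of_nonneg_left h3 (sq_nonneg s)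
        refine add_le_add le_rfl (mul_le_mul_of_nonneg_left ?_ hB)
        linarith

end NoisyGradient

/-! ### The trajectory as a Markov chain on feasible points. -/

section Chain

variable {d : ℕ} {Z : Type*}

/-- States as points of a product space, on which topology and measurability are available. -/
abbrev Pt (d : ℕ) := (Vec d × Vec d) × Vec d × Vec d

/-- The state represented by a point. -/
def toState (x : Pt d) : State d := ⟨x.1.1, x.1.2, x.2.1, x.2.2⟩

/-- Initialization with deterministic oracles. -/
def initPt (gθ gω : Vec d → Vec d → Z → Vec d) (A : Params d) (h : Z × Vec d × Vec d) : Pt d :=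
  ((A.θ₀, A.ω₀), gθ A.θ₀ A.ω₀ h.1 + h.2.1, gω A.θ₀ A.ω₀ h.1 + h.2.2)

/-- Iteration with deterministic oracles. -/
noncomputable def stepPt (gθ gω : Vec d → Vec d → Z → Vec d) (A : Params d) (t : ℕ) (x : Pt d)
    (h : Z × Vec d × Vec d) : Pt d :=
  ((nextTheta A (A.ν t) (toState x), nextOmega A (A.ν t) (toState x)),
    (1 - A.α * A.ν t) • x.2.1 + (A.α * A.ν t) •
      gθ (nextTheta A (A.ν t) (toState x)) (nextOmega A (A.ν t) (toState x)) h.1 + h.2.1,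
    (1 - A.β * A.ν t) • x.2.2 + (A.β * A.ν t) •
      gω (nextTheta A (A.ν t) (toState x)) (nextOmega A (A.ν t) (toState x)) h.1 + h.2.2)

/-- The trajectory generated by deterministic oracles. -/
noncomputable def path (gθ gω : Vec d → Vec d → Z → Vec d) (A : Params d)
    (z : ℕ → Z × Vec d × Vec d) : ℕ → Pt d
  | 0 => initPt gθ gω A (z 0)
  | t + 1 => stepPt gθ gω A t (path gθ gω A z t) (z (t + 1))

/-- Separates the monadic program into a deterministic recursion for the state and a counter that
grows by two per stage. -/
lemma execute_eq (f : Vec d → Vec d → Z → ℝ) (A : Params d) (z : ℕ → Z × Vec d × Vec d) (t : ℕ) :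
    execute f A z t
      = (toState (path (lossGradTheta f) (lossGradOmega f) A z t), 2 * (t + 1)) := by
  induction t with
  | zero => rfl
  | succ t ih =>
    have h1 : execute f A z (t + 1) = StateT.run (m := Id)
        (step (counting (lossGradTheta f)) (counting (lossGradOmega f)) A t (z (t + 1)).1
          (z (t + 1)).2.1 (z (t + 1)).2.2 (execute f A z t).1) (execute f A z t).2 := rfl
    rw [h1, ih]
    rfl

/-- The points whose iterates are feasible. -/
def feasible (A : Params d) : Set (Pt d) := (A.Θ ×ˢ A.W) ×ˢ Set.univ

lemma mem_feasible {A : Params d} {x : Pt d} : x ∈ feasible A ↔ x.1.1 ∈ A.Θ ∧ x.1.2 ∈ A.W := by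
  simp [feasible, Set.mem_prod]

variable {A : Params d}

/-- Conditions on the parameters that keep the iterates feasible. -/
structure IsFeasible (A : Params d) : Prop where
  closed_primal : IsClosed A.Θ
  convex_primal : Convex ℝ A.Θ
  closed_dual : IsClosed A.W
  convex_dual : Convex ℝ A.W
  init_primal : A.θ₀ ∈ A.Θ
  init_dual : A.ω₀ ∈ A.W
  nu_pos : ∀ t, 0 < A.ν t
  nu_le : ∀ t, A.ν t ≤ 1 / 4

namespace IsFeasible

lemma next_mem (hA : IsFeasible A) (t : ℕ) {x : Pt d} (hx : x ∈ feasible A) :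
    nextTheta A (A.ν t) (toState x) ∈ A.Θ ∧ nextOmega A (A.ν t) (toState x) ∈ A.W := by
  rw [mem_feasible] at hx
  have hν : A.ν t ∈ Set.Icc (0 : ℝ) 1 :=
    ⟨(hA.nu_pos t).le, (hA.nu_le t).trans (by norm_num)⟩
  exact ⟨hA.convex_primal.add_smul_sub_mem hx.1
      (proj_spec ⟨_, hx.1⟩ hA.closed_primal hA.convex_primal _).1 hν,
    hA.convex_dual.add_smul_sub_mem hx.2
      (proj_spec ⟨_, hx.2⟩ hA.closed_dual hA.convex_dual _).1 hν⟩

lemma stepPt_mem (hA : IsFeasible A) (gθ gω : Vec d → Vec d → Z → Vec d) (t : ℕ) {x : Pt d}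
    (hx : x ∈ feasible A) (h : Z × Vec d × Vec d) : stepPt gθ gω A t x h ∈ feasible A :=
  mem_feasible.2 (hA.next_mem t hx)

lemma initPt_mem (hA : IsFeasible A) (gθ gω : Vec d → Vec d → Z → Vec d) (h : Z × Vec d × Vec d) :
    initPt gθ gω A h ∈ feasible A :=
  mem_feasible.2 ⟨hA.init_primal, hA.init_dual⟩

lemma path_mem (hA : IsFeasible A) (gθ gω : Vec d → Vec d → Z → Vec d)
    (z : ℕ → Z × Vec d × Vec d) (t : ℕ) : path gθ gω A z t ∈ feasible A := by
  cases t with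
  | zero => exact hA.initPt_mem gθ gω _
  | succ t =>
    induction t with
    | zero => exact hA.stepPt_mem gθ gω _ (hA.initPt_mem gθ gω _) _
    | succ t ih => exact hA.stepPt_mem gθ gω _ ih _

lemma initPt_congr (hA : IsFeasible A) {gθ gω gθ' gω' : Vec d → Vec d → Z → Vec d}
    (h1 : ∀ θ ∈ A.Θ, ∀ ω ∈ A.W, ∀ ξ, gθ θ ω ξ = gθ' θ ω ξ)
    (h2 : ∀ θ ∈ A.Θ, ∀ ω ∈ A.W, ∀ ξ, gω θ ω ξ = gω' θ ω ξ) :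
    initPt gθ gω A = initPt gθ' gω' A := by
  funext h
  simp only [initPt]
  rw [h1 _ hA.init_primal _ hA.init_dual, h2 _ hA.init_primal _ hA.init_dual]

lemma stepPt_congr (hA : IsFeasible A) {gθ gω gθ' gω' : Vec d → Vec d → Z → Vec d}
    (h1 : ∀ θ ∈ A.Θ, ∀ ω ∈ A.W, ∀ ξ, gθ θ ω ξ = gθ' θ ω ξ)
    (h2 : ∀ θ ∈ A.Θ, ∀ ω ∈ A.W, ∀ ξ, gω θ ω ξ = gω' θ ω ξ)
    (t : ℕ) {x : Pt d} (hx : x ∈ feasible A) (h : Z × Vec d × Vec d) :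
    stepPt gθ gω A t x h = stepPt gθ' gω' A t x h := by
  have hm := mem_feasible.1 (hA.stepPt_mem gθ gω t hx h)
  simp only [stepPt] at hm ⊢
  rw [h1 _ hm.1 _ hm.2, h2 _ hm.1 _ hm.2]

lemma path_congr (hA : IsFeasible A) {gθ gω gθ' gω' : Vec d → Vec d → Z → Vec d}
    (h1 : ∀ θ ∈ A.Θ, ∀ ω ∈ A.W, ∀ ξ, gθ θ ω ξ = gθ' θ ω ξ)
    (h2 : ∀ θ ∈ A.Θ, ∀ ω ∈ A.W, ∀ ξ, gω θ ω ξ = gω' θ ω ξ)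
    (z : ℕ → Z × Vec d × Vec d) (t : ℕ) : path gθ gω A z t = path gθ' gω' A z t := by
  induction t with
  | zero => exact congrFun (hA.initPt_congr h1 h2) _
  | succ t ih =>
    simp only [path, ← ih]
    exact hA.stepPt_congr h1 h2 t (hA.path_mem gθ gω z t) _

lemma continuous_thetaTilde (hA : IsFeasible A) :
    Continuous fun x : Pt d => thetaTilde A (toState x) := by
  have := continuous_proj ⟨_, hA.init_primal⟩ hA.closed_primal hA.convex_primal
  exact this.comp (by simp only [toState]; fun_prop)

lemma continuous_omegaTilde (hA : IsFeasible A) :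
    Continuous fun x : Pt d => omegaTilde A (toState x) := by
  have := continuous_proj ⟨_, hA.init_dual⟩ hA.closed_dual hA.convex_dual
  exact this.comp (by simp only [toState]; fun_prop)

lemma continuous_nextTheta (hA : IsFeasible A) (ν : ℝ) :
    Continuous fun x : Pt d => nextTheta A ν (toState x) :=
  continuous_fst.fst.add ((hA.continuous_thetaTilde.sub continuous_fst.fst).const_smul ν)

lemma continuous_nextOmega (hA : IsFeasible A) (ν : ℝ) :
    Continuous fun x : Pt d => nextOmega A ν (toState x) :=
  continuous_fst.snd.add ((hA.continuous_omegaTilde.sub continuous_fst.snd).const_smul ν)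

lemma measurableSet_feasible (hA : IsFeasible A) : MeasurableSet (feasible A) :=
  (hA.closed_primal.measurableSet.prod hA.closed_dual.measurableSet).prod MeasurableSet.univ

variable [MeasurableSpace Z] {gθ gω : Vec d → Vec d → Z → Vec d}

lemma measurable_stepPt (hA : IsFeasible A)
    (hθ : Measurable fun q : (Vec d × Vec d) × Z => gθ q.1.1 q.1.2 q.2)
    (hω : Measurable fun q : (Vec d × Vec d) × Z => gω q.1.1 q.1.2 q.2) (t : ℕ) :
    Measurable fun q : Pt d × (Z × Vec d × Vec d) => stepPt gθ gω A t q.1 q.2 := by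
  have hf : Measurable (Prod.fst : Pt d × (Z × Vec d × Vec d) → Pt d) := measurable_fst
  have hs : Measurable (Prod.snd : Pt d × (Z × Vec d × Vec d) → Z × Vec d × Vec d) :=
    measurable_snd
  have m1 : Measurable fun q : Pt d × (Z × Vec d × Vec d) =>
      nextTheta A (A.ν t) (toState q.1) :=
    (hA.continuous_nextTheta (A.ν t)).measurable.comp hf
  have m2 : Measurable fun q : Pt d × (Z × Vec d × Vec d) =>
      nextOmega A (A.ν t) (toState q.1) :=
    (hA.continuous_nextOmega (A.ν t)).measurable.comp hf
  have m0 := (m1.prodMk m2).prodMk hs.fst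
  have m3 : Measurable fun q : Pt d × (Z × Vec d × Vec d) =>
      gθ (nextTheta A (A.ν t) (toState q.1)) (nextOmega A (A.ν t) (toState q.1)) q.2.1 :=
    hθ.comp m0
  have m4 : Measurable fun q : Pt d × (Z × Vec d × Vec d) =>
      gω (nextTheta A (A.ν t) (toState q.1)) (nextOmega A (A.ν t) (toState q.1)) q.2.1 :=
    hω.comp m0
  have m5 : Measurable fun q : Pt d × (Z × Vec d × Vec d) => (1 - A.α * A.ν t) • q.1.2.1 :=
    hf.snd.fst.const_smul (1 - A.α * A.ν t)
  have m6 : Measurable fun q : Pt d × (Z × Vec d × Vec d) => (1 - A.β * A.ν t) • q.1.2.2 :=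
    hf.snd.snd.const_smul (1 - A.β * A.ν t)
  have m7 := (m5.add (m3.const_smul (A.α * A.ν t))).add hs.snd.fst
  have m8 := (m6.add (m4.const_smul (A.β * A.ν t))).add hs.snd.snd
  exact (m1.prodMk m2).prodMk (m7.prodMk m8)

lemma measurable_initPt
    (hθ : Measurable fun q : (Vec d × Vec d) × Z => gθ q.1.1 q.1.2 q.2)
    (hω : Measurable fun q : (Vec d × Vec d) × Z => gω q.1.1 q.1.2 q.2) :
    Measurable (initPt gθ gω A) := by
  have m3 := hθ.comp (f := fun q : Z × Vec d × Vec d => ((A.θ₀, A.ω₀), q.1)) (by fun_prop)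
  have m4 := hω.comp (f := fun q : Z × Vec d × Vec d => ((A.θ₀, A.ω₀), q.1)) (by fun_prop)
  simp only [Function.comp_def] at m3 m4
  exact measurable_const.prodMk ((m3.add (by fun_prop)).prodMk (m4.add (by fun_prop)))

/-- The trajectory up to time `t` is determined by the inputs up to time `t`. -/
lemma measurable_path_iSup (hA : IsFeasible A)
    (hθ : Measurable fun q : (Vec d × Vec d) × Z => gθ q.1.1 q.1.2 q.2)
    (hω : Measurable fun q : (Vec d × Vec d) × Z => gω q.1.1 q.1.2 q.2) (t : ℕ) :
    Measurable[⨆ k ∈ Set.Iic t, MeasurableSpace.comap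
      (fun z : ℕ → Z × Vec d × Vec d => z k) inferInstance] fun z => path gθ gω A z t := by
  have hcoord : ∀ t : ℕ, Measurable[⨆ k ∈ Set.Iic t, MeasurableSpace.comap
      (fun z : ℕ → Z × Vec d × Vec d => z k) inferInstance]
      fun z : ℕ → Z × Vec d × Vec d => z t := fun t =>
    (comap_measurable _).mono (le_iSup₂_of_le t Set.self_mem_Iic le_rfl) le_rfl
  induction t with
  | zero => exact (measurable_initPt hθ hω).comp (hcoord 0)
  | succ t ih =>
    have h1 := ih.mono (biSup_mono (f := fun k => MeasurableSpace.comap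
      (fun z : ℕ → Z × Vec d × Vec d => z k) inferInstance)
      (fun k (hk : k ∈ Set.Iic t) => (Set.Iic_subset_Iic.2 t.le_succ) hk)) le_rfl
    exact (hA.measurable_stepPt hθ hω t).comp (h1.prodMk (hcoord (t + 1)))

lemma measurable_path (hA : IsFeasible A)
    (hθ : Measurable fun q : (Vec d × Vec d) × Z => gθ q.1.1 q.1.2 q.2)
    (hω : Measurable fun q : (Vec d × Vec d) × Z => gω q.1.1 q.1.2 q.2) (t : ℕ) :
    Measurable fun z => path gθ gω A z t :=
  (hA.measurable_path_iSup hθ hω t).mono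
    (iSup₂_le fun k _ => (measurable_pi_apply k).comap_le) le_rfl

/-- The Markov property of the trajectory driven by i.i.d. inputs. -/
lemma lintegral_path_succ (hA : IsFeasible A)
    (hθ : Measurable fun q : (Vec d × Vec d) × Z => gθ q.1.1 q.1.2 q.2)
    (hω : Measurable fun q : (Vec d × Vec d) × Z => gω q.1.1 q.1.2 q.2)
    (Λ : Measure (Z × Vec d × Vec d)) [IsProbabilityMeasure Λ] (t : ℕ) {Φ : Pt d → ENNReal}
    (hΦ : Measurable Φ) :
    ∫⁻ z, Φ (path gθ gω A z (t + 1)) ∂(Measure.infinitePi fun _ : ℕ => Λ)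
      = ∫⁻ z, ∫⁻ h, Φ (stepPt gθ gω A t (path gθ gω A z t) h) ∂Λ
          ∂(Measure.infinitePi fun _ : ℕ => Λ) := by
  set Q := Measure.infinitePi fun _ : ℕ => Λ
  have hind : iIndepFun (fun (k : ℕ) (z : ℕ → Z × Vec d × Vec d) => z k) Q :=
    iIndepFun_infinitePi (P := fun _ : ℕ => Λ) (X := fun _ x => x) (fun _ => measurable_id)
  have hpair : IndepFun (fun z => path gθ gω A z t) (fun z : ℕ → Z × Vec d × Vec d => z (t + 1))
      Q := by
    -- The path at time t uses inputs 0, …, t only, hence is independent of input t + 1.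
    have h1 := indep_iSup_of_disjoint (fun k => (measurable_pi_apply k).comap_le) hind.iIndep
      (S := Set.Iic t) (T := {t + 1}) (by simp)
    rw [IndepFun_iff_Indep]
    refine indep_of_indep_of_le_left (indep_of_indep_of_le_right h1 ?_) ?_
    · simp
    · exact (hA.measurable_path_iSup hθ hω t).comap_le
  have hmp := hA.measurable_path hθ hω t
  have hms := hΦ.comp (hA.measurable_stepPt hθ hω t)
  have hlaw := (indepFun_iff_map_prod_eq_prod_map_map hmp.aemeasurable
    (measurable_pi_apply (t + 1)).aemeasurable).1 hpair
  have hev : Q.map (fun z : ℕ → Z × Vec d × Vec d => z (t + 1)) = Λ :=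
    Measure.infinitePi_map_eval (μ := fun _ : ℕ => Λ) (t + 1)
  rw [hev] at hlaw
  have : IsProbabilityMeasure (Q.map fun z => path gθ gω A z t) :=
    Measure.isProbabilityMeasure_map hmp.aemeasurable
  calc _ = ∫⁻ q, Φ (stepPt gθ gω A t q.1 q.2)
        ∂(Q.map fun z => (path gθ gω A z t, z (t + 1))) :=
        (lintegral_map hms (hmp.prodMk (measurable_pi_apply (t + 1)))).symm
    _ = ∫⁻ x, ∫⁻ h, Φ (stepPt gθ gω A t x h) ∂Λ ∂(Q.map fun z => path gθ gω A z t) := by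
        rw [hlaw]
        exact lintegral_prod _ hms.aemeasurable
    _ = _ := lintegral_map hms.lintegral_prod_right' hmp

end IsFeasible

end Chain

/-! ### Regularity of the maximizer, the gradients and the primal function. -/

lemma measurable_indicator_of_continuousOn {X Y : Type*} [TopologicalSpace X] [MeasurableSpace X]
    [OpensMeasurableSpace X] [TopologicalSpace Y] [MeasurableSpace Y] [BorelSpace Y] [Zero Y]
    {g : X → Y} {s : Set X} (hg : ContinuousOn g s) (hs : MeasurableSet s) :
    Measurable (s.indicator g) := by
  classical
  rw [← Set.piecewise_eq_indicator]
  exact hg.measurable_piecewise continuousOn_const hs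

namespace IsSaddle

variable {d : ℕ} {F : Vec d → Vec d → ℝ} {Θ W : Set (Vec d)} {L μ : ℝ}

lemma continuousOn_grad (h : IsSaddle F Θ W L μ) :
    ContinuousOn (fun z : Vec d × Vec d => gradTheta F z.1 z.2) (Θ ×ˢ W) ∧
    ContinuousOn (fun z : Vec d × Vec d => gradOmega F z.1 z.2) (Θ ×ˢ W) := by
  have hb : ∀ z z' : Vec d × Vec d, L * pairNorm (z.1 - z'.1) (z.2 - z'.2) ≤ 2 * L * dist z z' := by
    intro z z'
    have h1 : ‖z.1 - z'.1‖ ≤ dist z z' := by rw [dist_eq_norm]; exact norm_fst_le (z - z')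
    have h2 : ‖z.2 - z'.2‖ ≤ dist z z' := by rw [dist_eq_norm]; exact norm_snd_le (z - z')
    -- The product carries the sup distance, so passing to the ℓ² norm costs a factor √2, rounded up
    -- to 2.
    have h3 : pairNorm (z.1 - z'.1) (z.2 - z'.2) ≤ 2 * dist z z' := by
      rw [pairNorm]
      apply Real.sqrt_le_iff.2 ⟨by positivity, ?_⟩
      nlinarith [norm_nonneg (z.1 - z'.1), norm_nonneg (z.2 - z'.2)]
    nlinarith [h.pos']
  have hL : 0 ≤ 2 * L := by linarith [h.pos']
  constructor
  · refine (LipschitzOnWith.of_dist_le_mul (K := NNReal.mk (2 * L) hL) fun z hz z' hz' => ?_).continuousOn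
    rw [dist_eq_norm]
    exact (norm_le_pairNorm_left _ _).trans
      ((h.smooth _ hz.1 _ hz'.1 _ hz.2 _ hz'.2).trans (hb z z'))
  · refine (LipschitzOnWith.of_dist_le_mul (K := NNReal.mk (2 * L) hL) fun z hz z' hz' => ?_).continuousOn
    rw [dist_eq_norm]
    exact (norm_le_pairNorm_right _ _).trans
      ((h.smooth _ hz.1 _ hz'.1 _ hz.2 _ hz'.2).trans (hb z z'))

lemma continuousOn_argmaxOn (h : IsSaddle F Θ W L μ) :
    ContinuousOn (fun θ => argmaxOn W (F θ)) Θ := by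
  refine (LipschitzOnWith.of_dist_le_mul (K := NNReal.mk (L / μ) (div_pos h.pos' h.pos).le)
    fun θ hθ θ' hθ' => ?_).continuousOn
  have := h.mul_norm_argmaxOn_sub_le hθ hθ'
  rw [dist_eq_norm, dist_eq_norm, NNReal.coe_mk, div_mul_eq_mul_div, le_div_iff₀ h.pos]
  linarith

lemma continuousOn_primal (h : IsSaddle F Θ W L μ)
    (hF : ContinuousOn (fun z : Vec d × Vec d => F z.1 z.2) (Θ ×ˢ W)) :
    ContinuousOn (primal F W) Θ := by
  have h1 : ContinuousOn (fun θ => F θ (argmaxOn W (F θ))) Θ :=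
    hF.comp (f := fun θ => (θ, argmaxOn W (F θ)))
      (continuousOn_id.prodMk h.continuousOn_argmaxOn) fun θ hθ => ⟨hθ, h.argmaxOn_mem hθ⟩
  exact h1.congr fun θ hθ => h.primal_eq hθ

/-- With a Lipschitz objective, dual points are close to the maximizer. -/
lemma norm_sub_argmaxOn_le (h : IsSaddle F Θ W L μ) {G : ℝ} (hG : 0 ≤ G) {θ ω : Vec d} (hθ : θ ∈ Θ)
    (hω : ω ∈ W) (hF : ∀ y ∈ W, ∀ y' ∈ W, |F θ y - F θ y'| ≤ G * ‖y - y'‖) :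
    ‖ω - argmaxOn W (F θ)‖ * μ ≤ 2 * G := by
  have h1 := h.le_argmaxOn_sub hθ hω
  have h2 := (abs_le.1 (hF ω hω _ (h.argmaxOn_mem hθ))).1
  set x := ‖ω - argmaxOn W (F θ)‖
  rcases (norm_nonneg _ : 0 ≤ x).eq_or_lt with h0 | h0
  · have hx : x = 0 := h0.symm
    rw [hx, zero_mul]
    linarith
  -- Quadratic growth below the maximum against linear Lipschitz growth.
  · have h3 : x * μ * x ≤ 2 * G * x := by nlinarith
    exact le_of_mul_le_mul_right h3 h0

end IsSaddle

/-! ### Globally measurable oracles. -/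

section Masked

variable {d : ℕ} {Z : Type*}

/-- The primal oracle, set to zero at infeasible points. -/
noncomputable def maskedTheta (f : Vec d → Vec d → Z → ℝ) (A : Params d) (θ ω : Vec d) (ξ : Z) :
    Vec d :=
  ((A.Θ ×ˢ A.W) ×ˢ (Set.univ : Set Z)).indicator (fun q => lossGradTheta f q.1.1 q.1.2 q.2)
    ((θ, ω), ξ)

/-- The dual oracle, set to zero at infeasible points. -/
noncomputable def maskedOmega (f : Vec d → Vec d → Z → ℝ) (A : Params d) (θ ω : Vec d) (ξ : Z) :
    Vec d :=
  ((A.Θ ×ˢ A.W) ×ˢ (Set.univ : Set Z)).indicator (fun q => lossGradOmega f q.1.1 q.1.2 q.2)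
    ((θ, ω), ξ)

/-- Since the iterates stay feasible, this agreement lets the masked oracles, which are measurable
everywhere, generate the same trajectory. -/
lemma maskedTheta_eq (f : Vec d → Vec d → Z → ℝ) (A : Params d) :
    ∀ θ ∈ A.Θ, ∀ ω ∈ A.W, ∀ ξ, lossGradTheta f θ ω ξ = maskedTheta f A θ ω ξ :=
  fun θ hθ ω hω ξ => by
    rw [maskedTheta, Set.indicator_of_mem]
    exact ⟨⟨hθ, hω⟩, Set.mem_univ ξ⟩

lemma maskedOmega_eq (f : Vec d → Vec d → Z → ℝ) (A : Params d) :
    ∀ θ ∈ A.Θ, ∀ ω ∈ A.W, ∀ ξ, lossGradOmega f θ ω ξ = maskedOmega f A θ ω ξ :=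
  fun θ hθ ω hω ξ => by
    rw [maskedOmega, Set.indicator_of_mem]
    exact ⟨⟨hθ, hω⟩, Set.mem_univ ξ⟩

end Masked

/-! ### Expected decrease of the potential. -/

/-- The setting of the convergence analysis. -/
structure Setting {d : ℕ} {Z : Type*} [MeasurableSpace Z] (f : Vec d → Vec d → Z → ℝ)
    (Ξ : Measure Z) (D : Set (Vec d × Vec d)) (A : Params d) (L G μ : ℝ) : Prop where
  assumptions : Assumptions f Ξ A.Θ A.W D L G μ
  lipschitz_nonneg : 0 ≤ G
  concavity_pos : 0 < μ
  concavity_le : μ ≤ L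
  steps : AdmissibleSteps L μ A.κ A.η
  alpha : A.α = 3
  beta : A.β = 3
  init_primal : A.θ₀ ∈ A.Θ
  init_dual : A.ω₀ ∈ A.W
  nu_pos : ∀ t, 0 < A.ν t
  nu_le : ∀ t, A.ν t ≤ 1 / 4

namespace Setting

variable {d : ℕ} {Z : Type*} [MeasurableSpace Z] {f : Vec d → Vec d → Z → ℝ} {Ξ : Measure Z}
  {D : Set (Vec d × Vec d)} {A : Params d} {L G μ v J₀ : ℝ}

lemma isSaddle (H : Setting f Ξ D A L G μ) : IsSaddle (objective f Ξ) A.Θ A.W L μ :=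
  H.assumptions.isSaddle H.concavity_pos H.concavity_le ⟨_, H.init_dual⟩

lemma isFeasible (H : Setting f Ξ D A L G μ) : IsFeasible A where
  closed_primal := H.assumptions.closed_primal
  convex_primal := H.assumptions.convex_primal
  closed_dual := H.assumptions.closed_dual
  convex_dual := H.assumptions.convex_dual
  init_primal := H.init_primal
  init_dual := H.init_dual
  nu_pos := H.nu_pos
  nu_le := H.nu_le

lemma continuousOn_objective (H : Setting f Ξ D A L G μ) :
    ContinuousOn (fun z : Vec d × Vec d => objective f Ξ z.1 z.2) (A.Θ ×ˢ A.W) := fun z hz =>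
  (H.assumptions.differentiable_objective z.1 hz.1 z.2 hz.2).continuousAt.continuousWithinAt

lemma continuousOn_grad_sub (H : Setting f Ξ D A L G μ) :
    ContinuousOn (fun x : Pt d => ‖gradTheta (objective f Ξ) x.1.1 x.1.2 - x.2.1‖) (feasible A) ∧
    ContinuousOn (fun x : Pt d => ‖gradOmega (objective f Ξ) x.1.1 x.1.2 - x.2.2‖)
      (feasible A) := by
  have hfst : Set.MapsTo (Prod.fst : Pt d → Vec d × Vec d) (feasible A) (A.Θ ×ˢ A.W) :=
    fun x hx => hx.1
  have h1 := H.isSaddle.continuousOn_grad.1.comp continuousOn_fst hfst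
  have h2 := H.isSaddle.continuousOn_grad.2.comp continuousOn_fst hfst
  exact ⟨(h1.sub continuous_snd.fst.continuousOn).norm,
    (h2.sub continuous_snd.snd.continuousOn).norm⟩

lemma continuousOn_argmax_sub (H : Setting f Ξ D A L G μ) :
    ContinuousOn (fun x : Pt d => ‖x.1.2 - argmaxOn A.W (objective f Ξ x.1.1)‖)
      (feasible A) := by
  have h1 := H.isSaddle.continuousOn_argmaxOn.comp (s := feasible A)
    (f := fun x : Pt d => x.1.1) continuous_fst.fst.continuousOn fun x hx => hx.1.1
  exact (continuous_fst.snd.continuousOn.sub h1).norm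

lemma continuousOn_metric (H : Setting f Ξ D A L G μ) :
    ContinuousOn (fun x => metric (objective f Ξ) L A (toState x)) (feasible A) := by
  have h1 : Continuous fun x : Pt d => ‖thetaTilde A (toState x) - x.1.1‖ :=
    (H.isFeasible.continuous_thetaTilde.sub continuous_fst.fst).norm
  exact ((h1.const_mul A.κ⁻¹).continuousOn.add H.continuousOn_grad_sub.1).add
    (H.continuousOn_argmax_sub.const_mul L)

lemma continuousOn_potential (H : Setting f Ξ D A L G μ) :
    ContinuousOn (fun x => potential (objective f Ξ) L μ A (toState x)) (feasible A) := by
  have h1 := (H.isSaddle.continuousOn_primal H.continuousOn_objective).comp (s := feasible A)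
    (f := fun x : Pt d => x.1.1) continuous_fst.fst.continuousOn fun x hx => hx.1.1
  exact (h1.add ((H.continuousOn_argmax_sub.pow 2).const_mul _)).add
    (((H.continuousOn_grad_sub.1.pow 2).add (H.continuousOn_grad_sub.2.pow 2)).const_mul _)

lemma measurable_lossPath (H : Setting f Ξ D A L G μ) (t : ℕ) :
    Measurable fun z => path (lossGradTheta f) (lossGradOmega f) A z t := by
  simp_rw [H.isFeasible.path_congr (maskedTheta_eq f A) (maskedOmega_eq f A)]
  exact H.isFeasible.measurable_path H.assumptions.measurable_lossGradTheta
    H.assumptions.measurable_lossGradOmega t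

lemma measurable_metric_path (H : Setting f Ξ D A L G μ) (t : ℕ) :
    Measurable fun z => metric (objective f Ξ) L A
      (toState (path (lossGradTheta f) (lossGradOmega f) A z t)) := by
  have h := (measurable_indicator_of_continuousOn H.continuousOn_metric
    H.isFeasible.measurableSet_feasible).comp (H.measurable_lossPath t)
  convert h using 1
  funext z
  exact (Set.indicator_of_mem (H.isFeasible.path_mem _ _ z t)
    fun x => metric (objective f Ξ) L A (toState x)).symm

lemma lintegral_lossPath_zero (H : Setting f Ξ D A L G μ) (Λ : Measure (Z × Vec d × Vec d))
    [IsProbabilityMeasure Λ] {Φ : Pt d → ENNReal} (hΦ : Measurable ((feasible A).indicator Φ)) :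
    ∫⁻ z, Φ (path (lossGradTheta f) (lossGradOmega f) A z 0)
        ∂(Measure.infinitePi fun _ : ℕ => Λ)
      = ∫⁻ h, Φ (initPt (lossGradTheta f) (lossGradOmega f) A h) ∂Λ := by
  have hA := H.isFeasible
  have hm : Measurable fun h => Φ (initPt (lossGradTheta f) (lossGradOmega f) A h) := by
    have h1 := hΦ.comp (IsFeasible.measurable_initPt (A := A)
      (gθ := maskedTheta f A) (gω := maskedOmega f A)
      H.assumptions.measurable_lossGradTheta H.assumptions.measurable_lossGradOmega)
    rw [hA.initPt_congr (maskedTheta_eq f A) (maskedOmega_eq f A)]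
    convert h1 using 1
    funext h
    exact (Set.indicator_of_mem (hA.initPt_mem _ _ h) _).symm
  have hev : (Measure.infinitePi fun _ : ℕ => Λ).map (fun z => z 0) = Λ :=
    Measure.infinitePi_map_eval (μ := fun _ : ℕ => Λ) 0
  calc _ = ∫⁻ h, Φ (initPt (lossGradTheta f) (lossGradOmega f) A h)
        ∂((Measure.infinitePi fun _ : ℕ => Λ).map fun z => z 0) :=
        (lintegral_map hm (measurable_pi_apply 0)).symm
    _ = _ := by rw [hev]

lemma lintegral_lossPath_succ (H : Setting f Ξ D A L G μ) (Λ : Measure (Z × Vec d × Vec d))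
    [IsProbabilityMeasure Λ] (t : ℕ) {Φ : Pt d → ENNReal}
    (hΦ : Measurable ((feasible A).indicator Φ)) :
    ∫⁻ z, Φ (path (lossGradTheta f) (lossGradOmega f) A z (t + 1))
        ∂(Measure.infinitePi fun _ : ℕ => Λ)
      = ∫⁻ z, ∫⁻ h, Φ (stepPt (lossGradTheta f) (lossGradOmega f) A t
          (path (lossGradTheta f) (lossGradOmega f) A z t) h) ∂Λ
          ∂(Measure.infinitePi fun _ : ℕ => Λ) := by
  have hA := H.isFeasible
  have h1 := hA.lintegral_path_succ (gθ := maskedTheta f A) (gω := maskedOmega f A)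
    H.assumptions.measurable_lossGradTheta
    H.assumptions.measurable_lossGradOmega Λ t hΦ
  refine Eq.trans (lintegral_congr fun z => ?_) (h1.trans
    (lintegral_congr fun z => lintegral_congr fun h => ?_))
  · rw [hA.path_congr (maskedTheta_eq f A) (maskedOmega_eq f A)]
    exact (Set.indicator_of_mem (hA.path_mem _ _ z _) _).symm
  · rw [hA.path_congr (maskedTheta_eq f A) (maskedOmega_eq f A),
      hA.stepPt_congr (maskedTheta_eq f A) (maskedOmega_eq f A) t (hA.path_mem _ _ z _)]
    exact Set.indicator_of_mem (hA.stepPt_mem _ _ t (hA.path_mem _ _ z _) _) _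

/-- One iteration decreases the potential in expectation, up to the sampling and privacy noise. -/
lemma lintegral_potential_stepPt_le [IsProbabilityMeasure Ξ] (H : Setting f Ξ D A L G μ)
    (hv : 0 ≤ v) (hJ : ∀ θ ∈ A.Θ, J₀ ≤ primal (objective f Ξ) A.W θ) (t : ℕ) {x : Pt d}
    (hx : x ∈ feasible A) :
    ∫⁻ h, ENNReal.ofReal (potential (objective f Ξ) L μ A
        (toState (stepPt (lossGradTheta f) (lossGradOmega f) A t x h)) - J₀) ∂(stepLaw Ξ d v)
      + ENNReal.ofReal (A.ν t * A.κ / 10 * metric (objective f Ξ) L A (toState x) ^ 2)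
      ≤ ENNReal.ofReal (potential (objective f Ξ) L μ A (toState x) - J₀)
        + ENNReal.ofReal (errorWeight L μ A.κ * (9 * A.ν t ^ 2 * G ^ 2 + 2 * (d * v))) := by
  have hA := H.isFeasible
  have hS := H.isSaddle
  have hmem := mem_feasible.1 hx
  obtain ⟨hθ, hω⟩ := hA.next_mem t hx
  have hstep := potential_step_le hS H.steps (hA.nu_pos t) (hA.nu_le t) (s := toState x)
    hmem.1 hmem.2
  set s := toState x
  set ν := A.ν t with hν
  set θ := nextTheta A ν s with hθdef
  set ω := nextOmega A ν s with hωdef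
  set F := objective f Ξ
  have hB : 0 ≤ errorWeight L μ A.κ := by
    have := H.steps.kappa_pos
    rw [errorWeight]
    positivity
  -- Nonnegativity of the excess over J₀ means that `ENNReal.ofReal` truncates nothing.
  have hc : 0 ≤ iteratePotential F L μ A θ ω - J₀ := by
    have h1 := hJ θ hθ
    have h2 := H.steps.kappa_pos
    have h3 := H.steps.eta_pos
    have h4 := H.concavity_pos
    have h5 : 0 ≤ 6 * A.κ * L ^ 2 / (A.η * μ) * ‖ω - argmaxOn A.W (F θ)‖ ^ 2 := by positivity
    rw [iteratePotential]
    linarith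
  have hb := H.assumptions.lintegral_noisy_gradients_le H.lipschitz_nonneg hθ hω hv hc hB
    ((1 - 3 * ν) • (s.p - gradTheta F θ ω)) ((1 - 3 * ν) • (s.q - gradOmega F θ ω)) (3 * ν)
  -- Each new error is the shrunken old error, plus a centred sampling term of size 3ν, plus the
  -- Gaussian noise.
  have e : ∀ h : Z × Vec d × Vec d, potential F L μ A
      (toState (stepPt (lossGradTheta f) (lossGradOmega f) A t x h)) - J₀
      = iteratePotential F L μ A θ ω - J₀ + errorWeight L μ A.κ *
      (‖(1 - 3 * ν) • (s.p - gradTheta F θ ω)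
          + (3 * ν) • (lossGradTheta f θ ω h.1 - gradTheta F θ ω) + h.2.1‖ ^ 2
      + ‖(1 - 3 * ν) • (s.q - gradOmega F θ ω)
          + (3 * ν) • (lossGradOmega f θ ω h.1 - gradOmega F θ ω) + h.2.2‖ ^ 2) := by
    intro h
    have e1 : toState (stepPt (lossGradTheta f) (lossGradOmega f) A t x h)
        = ⟨θ, ω, (1 - 3 * ν) • s.p + (3 * ν) • lossGradTheta f θ ω h.1 + h.2.1,
          (1 - 3 * ν) • s.q + (3 * ν) • lossGradOmega f θ ω h.1 + h.2.2⟩ := by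
      simp only [stepPt, toState, H.alpha, H.beta]
      rfl
    rw [e1, potential]
    simp only
    rw [norm_sub_rev (gradTheta F θ ω), norm_sub_rev (gradOmega F θ ω)]
    have e2 : (1 - 3 * ν) • s.p + (3 * ν) • lossGradTheta f θ ω h.1 + h.2.1 - gradTheta F θ ω
        = (1 - 3 * ν) • (s.p - gradTheta F θ ω)
          + (3 * ν) • (lossGradTheta f θ ω h.1 - gradTheta F θ ω) + h.2.1 := by module
    have e3 : (1 - 3 * ν) • s.q + (3 * ν) • lossGradOmega f θ ω h.1 + h.2.2 - gradOmega F θ ω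
        = (1 - 3 * ν) • (s.q - gradOmega F θ ω)
          + (3 * ν) • (lossGradOmega f θ ω h.1 - gradOmega F θ ω) + h.2.2 := by module
    rw [e2, e3]
    ring
  simp_rw [e]
  have hdv : 0 ≤ (d : ℝ) * v := by positivity
  have hM : 0 ≤ ν * A.κ / 10 * metric F L A s ^ 2 := by
    have h1 := hA.nu_pos t
    have h2 := H.steps.kappa_pos
    positivity
  have hE : 0 ≤ errorWeight L μ A.κ * (9 * ν ^ 2 * G ^ 2 + 2 * (d * v)) := by positivity
  refine (add_le_add hb le_rfl).trans ?_
  rw [← ENNReal.ofReal_add (by positivity) hM, ← ENNReal.ofReal_add (by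
    have : 0 ≤ errorWeight L μ A.κ * (‖(1 - 3 * ν) • (s.p - gradTheta F θ ω)‖ ^ 2
      + ‖(1 - 3 * ν) • (s.q - gradOmega F θ ω)‖ ^ 2) := by positivity
    linarith) hE]
  apply ENNReal.ofReal_le_ofReal
  linarith

/-- The initial potential is bounded in expectation. -/
lemma lintegral_potential_initPt_le [IsProbabilityMeasure Ξ] (H : Setting f Ξ D A L G μ)
    (hv : 0 ≤ v) (hJ : ∀ θ ∈ A.Θ, J₀ ≤ primal (objective f Ξ) A.W θ) :
    ∫⁻ h, ENNReal.ofReal (potential (objective f Ξ) L μ A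
        (toState (initPt (lossGradTheta f) (lossGradOmega f) A h)) - J₀) ∂(stepLaw Ξ d v)
      ≤ ENNReal.ofReal (primal (objective f Ξ) A.W A.θ₀ - J₀
        + 6 * A.κ * L ^ 2 / (A.η * μ) * (2 * G / μ) ^ 2
        + errorWeight L μ A.κ * (G ^ 2 + 2 * (d * v))) := by
  set F := objective f Ξ with hF
  have hμ := H.concavity_pos
  have hκ := H.steps.kappa_pos
  have hη := H.steps.eta_pos
  have hθ := H.init_primal
  have hω := H.init_dual
  have hB : 0 ≤ errorWeight L μ A.κ := by
    rw [errorWeight]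
    positivity
  have hc : 0 ≤ iteratePotential F L μ A A.θ₀ A.ω₀ - J₀ := by
    have h1 := hJ _ hθ
    have h5 : 0 ≤ 6 * A.κ * L ^ 2 / (A.η * μ) * ‖A.ω₀ - argmaxOn A.W (F A.θ₀)‖ ^ 2 := by
      positivity
    rw [iteratePotential]
    linarith
  -- Initialization has no inherited error and takes the sampled gradient with full weight.
  have hb := H.assumptions.lintegral_noisy_gradients_le H.lipschitz_nonneg hθ hω hv hc hB 0 0 1
  have e : ∀ h : Z × Vec d × Vec d, potential F L μ A
      (toState (initPt (lossGradTheta f) (lossGradOmega f) A h)) - J₀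
      = iteratePotential F L μ A A.θ₀ A.ω₀ - J₀ + errorWeight L μ A.κ *
      (‖0 + (1 : ℝ) • (lossGradTheta f A.θ₀ A.ω₀ h.1 - gradTheta F A.θ₀ A.ω₀) + h.2.1‖ ^ 2
      + ‖0 + (1 : ℝ) • (lossGradOmega f A.θ₀ A.ω₀ h.1 - gradOmega F A.θ₀ A.ω₀) + h.2.2‖ ^ 2) := by
    intro h
    simp only [potential, toState, initPt, zero_add, one_smul]
    rw [norm_sub_rev (gradTheta F A.θ₀ A.ω₀), norm_sub_rev (gradOmega F A.θ₀ A.ω₀),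
      sub_add_eq_add_sub (lossGradTheta f A.θ₀ A.ω₀ h.1),
      sub_add_eq_add_sub (lossGradOmega f A.θ₀ A.ω₀ h.1)]
    ring
  simp_rw [e]
  refine hb.trans (ENNReal.ofReal_le_ofReal ?_)
  have hlip : ∀ y ∈ A.W, ∀ y' ∈ A.W, |F A.θ₀ y - F A.θ₀ y'| ≤ G * ‖y - y'‖ := by
    intro y hy y' hy'
    have m1 := H.assumptions.subset_dom (Set.mk_mem_prod hθ hy)
    have m2 := H.assumptions.subset_dom (Set.mk_mem_prod hθ hy')
    have i1 := H.assumptions.integrable_loss _ m1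
    have i2 := H.assumptions.integrable_loss _ m2
    rw [hF, objective, objective, ← integral_sub i1 i2]
    have h1 := norm_integral_le_of_norm_le_const (μ := Ξ) (C := G * ‖y - y'‖)
      (f := fun ξ => f A.θ₀ y ξ - f A.θ₀ y' ξ) (Filter.Eventually.of_forall fun ξ => by
        have := H.assumptions.lipschitz ξ _ m1 _ m2
        simpa [pairNorm_zero_left] using this)
    simpa using h1
  have h1 := H.isSaddle.norm_sub_argmaxOn_le H.lipschitz_nonneg hθ hω hlip
  rw [← le_div_iff₀ hμ] at h1
  have h2 := pow_le_pow_left₀ (norm_nonneg _) h1 2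
  have h3 := mul_le_mul_of_nonneg_left h2
    (by positivity : 0 ≤ 6 * A.κ * L ^ 2 / (A.η * μ))
  rw [iteratePotential]
  simp only [norm_zero]
  linarith

end Setting

/-! ### Telescoping along the trajectory. -/

namespace Setting

variable {d : ℕ} {Z : Type*} [MeasurableSpace Z] {f : Vec d → Vec d → Z → ℝ} {Ξ : Measure Z}
  {D : Set (Vec d × Vec d)} {A : Params d} {L G μ v J₀ : ℝ}

/-- Telescoped decrease of the potential. -/
lemma sum_lintegral_metric_sq_le [IsProbabilityMeasure Ξ] (H : Setting f Ξ D A L G μ)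
    (hv : 0 ≤ v) (hJ : ∀ θ ∈ A.Θ, J₀ ≤ primal (objective f Ξ) A.W θ) (T : ℕ) :
    ∑ t ∈ Finset.range T, ∫⁻ z, ENNReal.ofReal (A.ν t * A.κ / 10 * metric (objective f Ξ) L A
        (toState (path (lossGradTheta f) (lossGradOmega f) A z t)) ^ 2)
        ∂(Measure.infinitePi fun _ : ℕ => stepLaw Ξ d v)
      ≤ ENNReal.ofReal (primal (objective f Ξ) A.W A.θ₀ - J₀
        + 6 * A.κ * L ^ 2 / (A.η * μ) * (2 * G / μ) ^ 2
        + errorWeight L μ A.κ * (G ^ 2 + 2 * (d * v)))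
        + ∑ t ∈ Finset.range T,
          ENNReal.ofReal (errorWeight L μ A.κ * (9 * A.ν t ^ 2 * G ^ 2 + 2 * (d * v))) := by
  set Q := Measure.infinitePi fun _ : ℕ => stepLaw Ξ d v
  set Φ : Pt d → ENNReal := fun x =>
    ENNReal.ofReal (potential (objective f Ξ) L μ A (toState x) - J₀) with hΦ
  have hΦm : Measurable ((feasible A).indicator Φ) :=
    measurable_indicator_of_continuousOn (ENNReal.continuous_ofReal.comp_continuousOn
      (H.continuousOn_potential.sub continuousOn_const)) H.isFeasible.measurableSet_feasible
  have key : ∀ T : ℕ, ∫⁻ z, Φ (path (lossGradTheta f) (lossGradOmega f) A z T) ∂Q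
      + ∑ t ∈ Finset.range T, ∫⁻ z, ENNReal.ofReal (A.ν t * A.κ / 10 * metric (objective f Ξ) L A
        (toState (path (lossGradTheta f) (lossGradOmega f) A z t)) ^ 2) ∂Q
      ≤ ENNReal.ofReal (primal (objective f Ξ) A.W A.θ₀ - J₀
        + 6 * A.κ * L ^ 2 / (A.η * μ) * (2 * G / μ) ^ 2
        + errorWeight L μ A.κ * (G ^ 2 + 2 * (d * v)))
        + ∑ t ∈ Finset.range T,
          ENNReal.ofReal (errorWeight L μ A.κ * (9 * A.ν t ^ 2 * G ^ 2 + 2 * (d * v))) := by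
    intro T
    induction T with
    | zero =>
      simp only [Finset.range_zero, Finset.sum_empty, add_zero]
      rw [H.lintegral_lossPath_zero (stepLaw Ξ d v) hΦm]
      exact H.lintegral_potential_initPt_le hv hJ
    | succ T ih =>
      rw [Finset.sum_range_succ, Finset.sum_range_succ]
      have hm := H.measurable_metric_path T
      have hstep : ∫⁻ z, Φ (path (lossGradTheta f) (lossGradOmega f) A z (T + 1)) ∂Q
          + ∫⁻ z, ENNReal.ofReal (A.ν T * A.κ / 10 * metric (objective f Ξ) L A
            (toState (path (lossGradTheta f) (lossGradOmega f) A z T)) ^ 2) ∂Q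
          ≤ ∫⁻ z, Φ (path (lossGradTheta f) (lossGradOmega f) A z T) ∂Q
            + ENNReal.ofReal (errorWeight L μ A.κ * (9 * A.ν T ^ 2 * G ^ 2 + 2 * (d * v))) := by
        rw [H.lintegral_lossPath_succ (stepLaw Ξ d v) T hΦm,
          ← lintegral_add_right _ (by fun_prop)]
        calc _ ≤ ∫⁻ z, (Φ (path (lossGradTheta f) (lossGradOmega f) A z T)
              + ENNReal.ofReal (errorWeight L μ A.κ * (9 * A.ν T ^ 2 * G ^ 2 + 2 * (d * v)))) ∂Q :=
              lintegral_mono fun z => H.lintegral_potential_stepPt_le hv hJ T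
                (H.isFeasible.path_mem _ _ z T)
          _ = _ := by
              rw [lintegral_add_right _ measurable_const, lintegral_const, measure_univ, mul_one]
      calc _ = (∫⁻ z, Φ (path (lossGradTheta f) (lossGradOmega f) A z (T + 1)) ∂Q
          + ∫⁻ z, ENNReal.ofReal (A.ν T * A.κ / 10 * metric (objective f Ξ) L A
            (toState (path (lossGradTheta f) (lossGradOmega f) A z T)) ^ 2) ∂Q)
          + ∑ t ∈ Finset.range T, ∫⁻ z, ENNReal.ofReal (A.ν t * A.κ / 10 *
            metric (objective f Ξ) L A
              (toState (path (lossGradTheta f) (lossGradOmega f) A z t)) ^ 2) ∂Q := by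
            abel
        _ ≤ _ := by
            refine (add_le_add hstep le_rfl).trans ?_
            rw [add_right_comm, ← add_assoc]
            exact add_le_add ih le_rfl
  -- The terminal potential term is nonnegative and is dropped.
  exact le_add_self.trans (key T)

/-- Bound on the sum of the second moments of the metric. -/
lemma sum_lintegral_metric_sq_le_ofReal [IsProbabilityMeasure Ξ] (H : Setting f Ξ D A L G μ)
    (hv : 0 ≤ v) (hJ : ∀ θ ∈ A.Θ, J₀ ≤ primal (objective f Ξ) A.W θ) (T : ℕ) {ν : ℝ} (hν : 0 < ν)
    (hν' : ∀ t < T, ν ≤ A.ν t) :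
    ∑ t ∈ Finset.range T, ∫⁻ z, ENNReal.ofReal (metric (objective f Ξ) L A
        (toState (path (lossGradTheta f) (lossGradOmega f) A z t)) ^ 2)
        ∂(Measure.infinitePi fun _ : ℕ => stepLaw Ξ d v)
      ≤ ENNReal.ofReal (10 / (ν * A.κ) * (primal (objective f Ξ) A.W A.θ₀ - J₀
        + 6 * A.κ * L ^ 2 / (A.η * μ) * (2 * G / μ) ^ 2
        + errorWeight L μ A.κ * (G ^ 2 + 2 * (d * v))
        + ∑ t ∈ Finset.range T,
          errorWeight L μ A.κ * (9 * A.ν t ^ 2 * G ^ 2 + 2 * (d * v)))) := by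
  have hκ := H.steps.kappa_pos
  have hη := H.steps.eta_pos
  have hμ := H.concavity_pos
  have hJ0 := hJ _ H.init_primal
  have hdv : 0 ≤ (d : ℝ) * v := by positivity
  have hB : 0 ≤ errorWeight L μ A.κ := by
    rw [errorWeight]
    positivity
  have h := H.sum_lintegral_metric_sq_le hv hJ T
  have hS0 : 0 ≤ primal (objective f Ξ) A.W A.θ₀ - J₀
        + 6 * A.κ * L ^ 2 / (A.η * μ) * (2 * G / μ) ^ 2
        + errorWeight L μ A.κ * (G ^ 2 + 2 * (d * v)) := by
    have : 0 ≤ 6 * A.κ * L ^ 2 / (A.η * μ) * (2 * G / μ) ^ 2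
        + errorWeight L μ A.κ * (G ^ 2 + 2 * (d * v)) := by positivity
    linarith
  have he : ∀ t ∈ Finset.range T,
      0 ≤ errorWeight L μ A.κ * (9 * A.ν t ^ 2 * G ^ 2 + 2 * (d * v)) :=
    fun t _ => by positivity
  rw [← ENNReal.ofReal_sum_of_nonneg he, ← ENNReal.ofReal_add hS0 (Finset.sum_nonneg he)] at h
  have hw : 0 ≤ 10 / (ν * A.κ) := by positivity
  rw [ENNReal.ofReal_mul hw]
  refine le_trans ?_ (mul_le_mul_right h _)
  rw [Finset.mul_sum]
  refine Finset.sum_le_sum fun t ht => ?_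
  rw [← lintegral_const_mul' _ _ ENNReal.ofReal_ne_top]
  refine lintegral_mono fun z => ?_
  rw [← ENNReal.ofReal_mul hw]
  apply ENNReal.ofReal_le_ofReal
  set m := metric (objective f Ξ) L A
    (toState (path (lossGradTheta f) (lossGradOmega f) A z t)) ^ 2 with hm
  have hm0 : 0 ≤ m := sq_nonneg _
  have h1 := hν' t (Finset.mem_range.1 ht)
  calc m = 10 / (ν * A.κ) * (ν * A.κ / 10 * m) := by field_simp
    _ ≤ _ := by gcongr

end Setting

/-! ### The random output index. -/

section Output

/-- A finite second moment gives integrability, and nonnegativity of the variance bounds the mean.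
-/
lemma integrable_and_integral_le_sqrt {Ω : Type*} [MeasurableSpace Ω] {P : Measure Ω}
    [IsProbabilityMeasure P] {X : Ω → ℝ} (hX : AEMeasurable X P) {K : ℝ}
    (h : ∫⁻ ω, ENNReal.ofReal (X ω ^ 2) ∂P ≤ ENNReal.ofReal K) :
    Integrable X P ∧ ∫ ω, X ω ∂P ≤ Real.sqrt K := by
  have hi : Integrable (fun ω => X ω ^ 2) P := by
    refine ⟨(hX.pow_const 2).aestronglyMeasurable, ?_⟩
    rw [hasFiniteIntegral_iff_ofReal (Filter.Eventually.of_forall fun ω => sq_nonneg _)]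
    exact h.trans_lt ENNReal.ofReal_lt_top
  have hmem : MemLp X 2 P := (memLp_two_iff_integrable_sq hX.aestronglyMeasurable).2 hi
  refine ⟨hmem.integrable one_le_two, ?_⟩
  have h1 := variance_nonneg X P
  rw [variance_eq_sub hmem] at h1
  have h2 : ENNReal.ofReal (∫ ω, X ω ^ 2 ∂P) ≤ ENNReal.ofReal K := by
    rwa [ofReal_integral_eq_lintegral_ofReal hi
      (Filter.Eventually.of_forall fun ω => sq_nonneg _)]
  -- K may be negative. The truncated inequality returns to the reals only if the second moment is
  -- positive; otherwise the mean is 0.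
  rcases le_or_gt (∫ ω, X ω ^ 2 ∂P) 0 with h3 | h3
  · have h4 : (∫ ω, X ω ∂P) ^ 2 ≤ 0 := by
      have : P[X ^ 2] = ∫ ω, X ω ^ 2 ∂P := rfl
      linarith
    have h5 : ∫ ω, X ω ∂P = 0 := by nlinarith [sq_nonneg (∫ ω, X ω ∂P)]
    rw [h5]
    exact Real.sqrt_nonneg _
  · have h4 : ∫ ω, X ω ^ 2 ∂P ≤ K := by
      by_contra! hlt
      exact absurd h2 (not_le.2 ((ENNReal.ofReal_lt_ofReal_iff h3).2 hlt))
    apply Real.le_sqrt_of_sq_le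
    have : P[X ^ 2] = ∫ ω, X ω ^ 2 ∂P := rfl
    linarith

lemma uniformOn_univ_singleton {T : ℕ} (r : Fin T) :
    uniformOn (Set.univ : Set (Fin T)) {r} = (T : ENNReal)⁻¹ := by
  rw [uniformOn_univ, Measure.count_singleton, Fintype.card_fin, one_div]

variable {d T : ℕ} {Z S : Type*} [MeasurableSpace Z] [MeasurableSpace S]
  {P : Measure S} {Ξ : Measure Z} {v : ℝ}
  {ζ : ℕ → S → Z × Vec d × Vec d} {R : S → Fin T}

lemma IsRandomness.aemeasurable_pair (h : IsRandomness P Ξ v ζ R) :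
    AEMeasurable (fun s => (R s, fun t => ζ t s)) P :=
  h.index_law.aemeasurable.prodMk (aemeasurable_pi_iff.2 fun t => (h.law t).aemeasurable)

lemma IsRandomness.map_pair [IsProbabilityMeasure P] (h : IsRandomness P Ξ v ζ R) :
    P.map (fun s => (R s, fun t => ζ t s))
      = (uniformOn (Set.univ : Set (Fin T))).prod
        (Measure.infinitePi fun _ : ℕ => stepLaw Ξ d v) := by
  have hm : AEMeasurable (fun s t => ζ t s) P :=
    aemeasurable_pi_iff.2 fun t => (h.law t).aemeasurable
  rw [(indepFun_iff_map_prod_eq_prod_map_map h.index_law.aemeasurable hm).1 h.index_indep,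
    h.index_law.map_eq, (iIndepFun_iff_map_fun_eq_infinitePi_map₀ hm).1 h.indep]
  congr 2
  funext t
  exact (h.law t).map_eq

/-- The second moment at a uniform index is the average of the second moments. -/
lemma IsRandomness.lintegral_eq [IsProbabilityMeasure P] [IsProbabilityMeasure Ξ]
    (h : IsRandomness P Ξ v ζ R)
    {Φ : Fin T → (ℕ → Z × Vec d × Vec d) → ENNReal} (hΦ : ∀ r, Measurable (Φ r)) :
    ∫⁻ s, Φ (R s) (fun t => ζ t s) ∂P
      = (T : ENNReal)⁻¹ *
        ∑ r, ∫⁻ z, Φ r z ∂(Measure.infinitePi fun _ : ℕ => stepLaw Ξ d v) := by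
  have hm : Measurable fun q : Fin T × (ℕ → Z × Vec d × Vec d) => Φ q.1 q.2 :=
    measurable_from_prod_countable_right hΦ
  have h1 := lintegral_map' (μ := P) (hm.aemeasurable) h.aemeasurable_pair
  rw [h.map_pair] at h1
  rw [← h1, lintegral_prod _ hm.aemeasurable, lintegral_fintype, Finset.mul_sum]
  refine Finset.sum_congr rfl fun r _ => ?_
  rw [uniformOn_univ_singleton, mul_comm]

lemma IsRandomness.aemeasurable_comp (h : IsRandomness P Ξ v ζ R)
    {Φ : Fin T → (ℕ → Z × Vec d × Vec d) → ℝ} (hΦ : ∀ r, Measurable (Φ r)) :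
    AEMeasurable (fun s => Φ (R s) fun t => ζ t s) P :=
  (measurable_from_prod_countable_right hΦ :
    Measurable fun q : Fin T × (ℕ → Z × Vec d × Vec d) => Φ q.1 q.2).comp_aemeasurable
    h.aemeasurable_pair

end Output

/-! ### The logarithmic sum and the noise budget. -/

section Numerics

lemma sum_one_div_add_le_log {b : ℝ} (hb : 3 ≤ b) (T : ℕ) :
    ∑ t ∈ Finset.range T, 1 / ((t : ℝ) + b) ≤ Real.log (T + b) := by
  -- The shift by 1 makes the induction close: 1/(T + b) ≤ log(T + b) - log(T + b - 1).
  have key : ∀ T : ℕ, ∑ t ∈ Finset.range T, 1 / ((t : ℝ) + b) ≤ Real.log (T + b - 1) := by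
    intro T
    induction T with
    | zero =>
      simp only [Finset.range_zero, Finset.sum_empty, Nat.cast_zero, zero_add]
      exact Real.log_nonneg (by linarith)
    | succ T ih =>
      rw [Finset.sum_range_succ]
      have hT : (0 : ℝ) ≤ T := Nat.cast_nonneg T
      have h1 : 0 < (T : ℝ) + b := by linarith
      have h2 : 0 < (T : ℝ) + b - 1 := by linarith
      have h3 := Real.log_le_sub_one_of_pos (div_pos h2 h1)
      rw [Real.log_div h2.ne' h1.ne'] at h3
      have h4 : ((T : ℝ) + b - 1) / (T + b) - 1 = - (1 / (T + b)) := by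
        field_simp
        ring
      have h5 : ((T + 1 : ℕ) : ℝ) + b - 1 = T + b := by push_cast; ring
      rw [h5]
      linarith
  refine (key T).trans (Real.log_le_log ?_ (by linarith))
  linarith [(Nat.cast_nonneg T : (0 : ℝ) ≤ T)]

/-- The total privacy noise over T steps is bounded. The denominator of the variance reduces to
n²β'ε, the condition ε ≤ c log(1/δ) makes the Rényi order at most a multiple of log(1/δ)/ε, and T² d
log(1/δ) ≤ C²(nε)² cancels the rest. -/
lemma mul_noiseVariance_le {G ε δ β' C c : ℝ} {d n T : ℕ} (hd : 1 ≤ d) (hn : 1 ≤ n) (hε : 0 < ε)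
    (hδ : 0 < δ) (hδ' : δ < 1) (hβ₀ : 0 < β') (hβ₁ : β' < 1) (hC : 0 < C)
    (hc : ε ≤ c * Real.log (1 / δ)) (hT1 : 1 ≤ T)
    (hT : (T : ℝ) ≤ C * (n * ε / Real.sqrt (d * Real.log (1 / δ)))) :
    0 ≤ noiseVariance G n T ε δ β' ∧
    T * (d * noiseVariance G n T ε δ β') ≤ 14 * G ^ 2 * (1 / (1 - β') + |c|) * C ^ 2 / β' := by
  have hl : 0 < Real.log (1 / δ) := Real.log_pos (by rw [lt_div_iff₀ hδ]; linarith)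
  set l := Real.log (1 / δ) with hldef
  have hβ : 0 < 1 - β' := by linarith
  have hn0 : (0 : ℝ) < n := by exact_mod_cast hn
  have hd0 : (0 : ℝ) < d := by exact_mod_cast hd
  have hT0 : (0 : ℝ) < T := by exact_mod_cast hT1
  have e1 : ε - l / (renyiOrder ε δ β' - 1) = β' * ε := by
    rw [renyiOrder, add_sub_cancel_right, ← hldef]
    field_simp
    ring
  have h1 : 0 ≤ renyiOrder ε δ β' := by rw [renyiOrder, ← hldef]; positivity
  have h2 : renyiOrder ε δ β' ≤ l / ε * (1 / (1 - β') + |c|) := by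
    have h3 : 1 ≤ l / ε * |c| := by
      rw [div_mul_eq_mul_div, le_div_iff₀ hε]
      have := mul_le_mul_of_nonneg_right (le_abs_self c) hl.le
      linarith
    have h4 : l / ((1 - β') * ε) = l / ε * (1 / (1 - β')) := by field_simp
    rw [renyiOrder, ← hldef, h4]
    linarith
  have e2 : noiseVariance G n T ε δ β' = 14 * G ^ 2 * T * renyiOrder ε δ β' / (n ^ 2 * (β' * ε)) := by
    rw [noiseVariance, ← hldef, e1]
  rw [e2]
  refine ⟨by positivity, ?_⟩
  have hs : 0 < Real.sqrt (d * l) := Real.sqrt_pos.2 (by positivity)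
  have h5 : (T : ℝ) ^ 2 * (d * l) ≤ C ^ 2 * (n * ε) ^ 2 := by
    rw [mul_div_assoc', le_div_iff₀ hs] at hT
    have := pow_le_pow_left₀ (by positivity) hT 2
    rw [mul_pow, Real.sq_sqrt (by positivity), mul_pow] at this
    exact this
  have hk : 0 ≤ 1 / (1 - β') + |c| := by positivity
  calc (T : ℝ) * (d * (14 * G ^ 2 * T * renyiOrder ε δ β' / (n ^ 2 * (β' * ε))))
      ≤ T * (d * (14 * G ^ 2 * T * (l / ε * (1 / (1 - β') + |c|)) / (n ^ 2 * (β' * ε)))) := by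
        gcongr
    _ = 14 * G ^ 2 * (1 / (1 - β') + |c|) / (β' * (n * ε) ^ 2) * ((T : ℝ) ^ 2 * (d * l)) := by
        field_simp
    _ ≤ 14 * G ^ 2 * (1 / (1 - β') + |c|) / (β' * (n * ε) ^ 2) * (C ^ 2 * (n * ε) ^ 2) := by
        gcongr
    _ = _ := by field_simp

end Numerics

/-! ### Constants of the final bound. -/

section Final

/-- The bound on the potential budget, up to the logarithmic factor. -/
noncomputable def budget (G L μ η κ β' C c Δ : ℝ) : ℝ :=
  |Δ| + 6 * κ * L ^ 2 / (η * μ) * (2 * G / μ) ^ 2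
    + errorWeight L μ κ * (2 * G ^ 2 + 4 * (14 * G ^ 2 * (1 / (1 - β') + |c|) * C ^ 2 / β'))

/-- The constant of the utility bound. -/
noncomputable def utilityConstant (G L μ η κ b β' C c Δ : ℝ) : ℝ :=
  Real.sqrt (40 * Real.sqrt (1 + b) / κ * budget G L μ η κ β' C c Δ * Real.sqrt (2 / C))

lemma budget_bound {G L μ η κ b N Δ Δ' m : ℝ} {ν : ℕ → ℝ} {T : ℕ} (hμ : 0 < μ)
    (hη : 0 < η) (hκ : 0 < κ) (hb : 3 ≤ b) (hT : 1 ≤ T)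
    (hν : ∀ t : ℕ, ν t = 1 / (4 * Real.sqrt (t + b))) (hΔ : Δ' ≤ |Δ|) (hm : 0 ≤ m)
    (hN : T * m ≤ N) :
    Δ' + 6 * κ * L ^ 2 / (η * μ) * (2 * G / μ) ^ 2 + errorWeight L μ κ * (G ^ 2 + 2 * m)
      + ∑ t ∈ Finset.range T, errorWeight L μ κ * (9 * ν t ^ 2 * G ^ 2 + 2 * m)
      ≤ (|Δ| + 6 * κ * L ^ 2 / (η * μ) * (2 * G / μ) ^ 2
        + errorWeight L μ κ * (2 * G ^ 2 + 4 * N)) * Real.log (T + b) := by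
  have hB : 0 ≤ errorWeight L μ κ := by rw [errorWeight]; positivity
  have hT1 : (1 : ℝ) ≤ T := by exact_mod_cast hT
  -- Since T + b ≥ 4 > e, bounded terms are absorbed into the logarithm.
  have hlog : 1 ≤ Real.log (T + b) := by
    rw [Real.le_log_iff_exp_le (by linarith)]
    linarith [Real.exp_one_lt_d9]
  have hmN : m ≤ N := (le_mul_of_one_le_left hm hT1).trans hN
  have hsum : ∑ t ∈ Finset.range T, (9 * ν t ^ 2 * G ^ 2 + 2 * m)
      ≤ G ^ 2 * Real.log (T + b) + 2 * N := by
    have h1 : ∀ t : ℕ, ν t ^ 2 = 1 / 16 * (1 / (t + b)) := fun t => by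
      have : (0 : ℝ) ≤ t + b := by linarith [(Nat.cast_nonneg t : (0 : ℝ) ≤ t)]
      rw [hν, div_pow, mul_pow, Real.sq_sqrt this]
      field_simp
      norm_num
    have h2 := sum_one_div_add_le_log hb T
    have h3 : ∑ t ∈ Finset.range T, (9 * ν t ^ 2 * G ^ 2 + 2 * m)
        = 9 / 16 * G ^ 2 * (∑ t ∈ Finset.range T, 1 / ((t : ℝ) + b)) + 2 * (T * m) := by
      rw [Finset.sum_add_distrib, Finset.mul_sum, Finset.sum_const, Finset.card_range,
        nsmul_eq_mul]
      congr 1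
      · exact Finset.sum_congr rfl fun t _ => by rw [h1]; ring
      · ring
    rw [h3]
    have h4 : 9 / 16 * G ^ 2 * (∑ t ∈ Finset.range T, 1 / ((t : ℝ) + b))
        ≤ 9 / 16 * G ^ 2 * Real.log (T + b) := by gcongr
    have h5 : 0 ≤ G ^ 2 * Real.log (T + b) := by positivity
    linarith
  rw [← Finset.mul_sum]
  have hN0 : 0 ≤ N := hm.trans hmN
  have h6 := mul_le_mul_of_nonneg_left hsum hB
  have h7 : 0 ≤ |Δ| + 6 * κ * L ^ 2 / (η * μ) * (2 * G / μ) ^ 2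
      + errorWeight L μ κ * (G ^ 2 + 4 * N) := by positivity
  have h8 := mul_le_mul_of_nonneg_left hlog h7
  have h9 := mul_le_mul_of_nonneg_left hmN hB
  linarith

/-- Averaging over T indices and dividing by the last step size leaves a factor √(T + b)/T ≤ √(1 +
b)/√T. The hypothesis on X says 1/√T ≤ √(2/C) X², and the outer square root turns X² into X. -/
lemma sqrt_average_le {κ b S Λ C X : ℝ} {T : ℕ} (hκ : 0 < κ) (hb : 3 ≤ b) (hS : 0 ≤ S)
    (hΛ : 0 ≤ Λ) (hC : 0 < C) (hX : 0 ≤ X) (hT : 1 ≤ T) (hTX : 1 ≤ 2 / C * X ^ 4 * T) :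
    Real.sqrt ((T : ℝ)⁻¹ * (10 / (1 / (4 * Real.sqrt (T + b)) * κ) * (S * Λ)))
      ≤ Real.sqrt (40 * Real.sqrt (1 + b) / κ * S * Real.sqrt (2 / C)) * X * Real.sqrt Λ := by
  have hT1 : (1 : ℝ) ≤ T := by exact_mod_cast hT
  have hT0 : (0 : ℝ) < T := by linarith
  have h1 : Real.sqrt (T + b) ≤ Real.sqrt T * Real.sqrt (1 + b) := by
    rw [← Real.sqrt_mul hT0.le]
    apply Real.sqrt_le_sqrt
    nlinarith
  have h2 : (T : ℝ)⁻¹ * Real.sqrt T ≤ Real.sqrt (2 / C) * X ^ 2 := by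
    have h3 : 1 ≤ Real.sqrt (2 / C) * X ^ 2 * Real.sqrt T := by
      rw [← Real.sqrt_sq (sq_nonneg X), ← Real.sqrt_mul (by positivity),
        ← Real.sqrt_mul (by positivity), Real.one_le_sqrt]
      calc 1 ≤ 2 / C * X ^ 4 * T := hTX
        _ = _ := by ring
    rw [inv_mul_le_iff₀ hT0]
    calc Real.sqrt T = Real.sqrt T * 1 := (mul_one _).symm
      _ ≤ Real.sqrt T * (Real.sqrt (2 / C) * X ^ 2 * Real.sqrt T) := by gcongr
      _ = Real.sqrt T ^ 2 * (Real.sqrt (2 / C) * X ^ 2) := by ring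
      _ = _ := by rw [Real.sq_sqrt hT0.le]
  have h0 : 0 < Real.sqrt (T + b) := Real.sqrt_pos.2 (by linarith)
  have h3 : (T : ℝ)⁻¹ * (10 / (1 / (4 * Real.sqrt (T + b)) * κ) * (S * Λ))
      ≤ (40 * Real.sqrt (1 + b) / κ * S * Real.sqrt (2 / C)) * (X ^ 2 * Λ) := by
    calc _ = 40 / κ * (S * Λ) * ((T : ℝ)⁻¹ * Real.sqrt (T + b)) := by
          field_simp
          norm_num
          ring
      _ ≤ 40 / κ * (S * Λ) * ((T : ℝ)⁻¹ * (Real.sqrt T * Real.sqrt (1 + b))) := by gcongr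
      _ = 40 / κ * (S * Λ) * Real.sqrt (1 + b) * ((T : ℝ)⁻¹ * Real.sqrt T) := by ring
      _ ≤ 40 / κ * (S * Λ) * Real.sqrt (1 + b) * (Real.sqrt (2 / C) * X ^ 2) := by gcongr
      _ = _ := by ring
  calc _ ≤ Real.sqrt ((40 * Real.sqrt (1 + b) / κ * S * Real.sqrt (2 / C)) * (X ^ 2 * Λ)) :=
        Real.sqrt_le_sqrt h3
    _ = _ := by
        rw [Real.sqrt_mul (by positivity), Real.sqrt_mul (sq_nonneg X), Real.sqrt_sq hX]
        ring

lemma admissibleSteps_of_le {L μ κ η : ℝ} (hμ : 0 < μ) (hμL : μ ≤ L) (hη : 0 < η)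
    (hη' : η ≤ μ / (4 * L ^ 2)) (hκ : 0 < κ) (hκ' : κ ≤ η * μ ^ 2 / (9 * L ^ 2)) :
    AdmissibleSteps L μ κ η := by
  have hL : 0 < L := hμ.trans_le hμL
  rw [le_div_iff₀ (by positivity)] at hη' hκ'
  exact ⟨hκ, hη, by linarith, by linarith⟩

end Final

end DPTD

/-! ### Assembly of the utility and complexity bounds. -/

theorem theorem5p2
    (G L_F μ η κ b β' C c Δ : ℝ)
    (hG : 0 ≤ G) (hμ : 0 < μ) (hμL : μ ≤ L_F)
    (hη : 0 < η) (hη' : η ≤ μ / (4 * L_F ^ 2))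
    (hκ : 0 < κ) (hκ' : κ ≤ η * μ ^ 2 / (9 * L_F ^ 2))
    (hb : max ((2 * κ * L_F ^ 2 / μ) ^ 2) 3 ≤ b)
    (hβ₀ : 0 < β') (hβ₁ : β' < 1) (hC : 0 < C) :
    ∃ K : ℝ, 0 < K ∧
      ∀ (d n T : ℕ) (ε δ : ℝ), 1 ≤ d → 1 ≤ n → 0 < ε → 0 < δ → δ < 1 →
        ε ≤ c * Real.log (1 / δ) →
        T = ⌊C * n * ε / Real.sqrt (d * Real.log (1 / δ))⌋₊ → 1 ≤ T →
      ∀ (Z : Type*) [MeasurableSpace Z] (Ξ : Measure Z) [IsProbabilityMeasure Ξ]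
        (f : DPTD.Vec d → DPTD.Vec d → Z → ℝ) (D : Set (DPTD.Vec d × DPTD.Vec d))
        (A : DPTD.Params d),
        A.κ = κ → A.η = η → A.α = 3 → A.β = 3 →
        (∀ t : ℕ, A.ν t = 1 / (4 * ((t : ℝ) + b) ^ (1 / 2 : ℝ))) →
        A.θ₀ ∈ A.Θ → A.ω₀ ∈ A.W →
        DPTD.Assumptions f Ξ A.Θ A.W D L_F G μ →
        (∀ θ ∈ A.Θ, DPTD.primal (DPTD.objective f Ξ) A.W A.θ₀
          - DPTD.primal (DPTD.objective f Ξ) A.W θ ≤ Δ) →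
      ∀ (S : Type*) [MeasurableSpace S] (P : Measure S) [IsProbabilityMeasure P]
        (ζ : ℕ → S → Z × DPTD.Vec d × DPTD.Vec d) (R : S → Fin T),
        DPTD.IsRandomness P Ξ (DPTD.noiseVariance G n T ε δ β') ζ R →
        (Integrable (fun s => DPTD.metric (DPTD.objective f Ξ) L_F A
            (DPTD.iterate f A (fun t => ζ t s) (R s))) P ∧
          ∫ s, DPTD.metric (DPTD.objective f Ξ) L_F A
              (DPTD.iterate f A (fun t => ζ t s) (R s)) ∂P
            ≤ K * ((d * Real.log (1 / δ)) ^ (1 / 8 : ℝ) / (n * ε) ^ (1 / 4 : ℝ))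
                * Real.sqrt (Real.log (T + b))) ∧
        (∀ s, DPTD.gradientComplexity f A (fun t => ζ t s) T = 2 * (T + 1)) ∧
        2 * ((T : ℝ) + 1) ≤ K * (n * ε / Real.sqrt (d * Real.log (1 / δ))) := by

  have hb3 : 3 ≤ b := (le_max_right _ _).trans hb
  have hL : 0 < L_F := hμ.trans_le hμL
  have hsteps := DPTD.admissibleSteps_of_le hμ hμL hη hη' hκ hκ'
  -- The summand 4C serves the gradient count: 2(T + 1) ≤ 4T ≤ 4C nε/√(d log(1/δ)). It also makes
  -- the constant positive.
  refine ⟨DPTD.utilityConstant G L_F μ η κ b β' C c Δ + 4 * C,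
    add_pos_of_nonneg_of_pos (Real.sqrt_nonneg _) (by linarith), ?_⟩
  intro d n T ε δ hd hn hε hδ hδ' hc hT hT1 Z _ Ξ _ f D A hAκ hAη hAα hAβ hAν hθ₀ hω₀ H hΔ
    S _ P _ ζ R hR
  subst hAκ hAη
  have hl : 0 < Real.log (1 / δ) := Real.log_pos (by rw [lt_div_iff₀ hδ]; linarith)
  have hn0 : (0 : ℝ) < n := by exact_mod_cast hn
  have hd0 : (0 : ℝ) < d := by exact_mod_cast hd
  have hT0 : (1 : ℝ) ≤ T := by exact_mod_cast hT1
  have hs : 0 < Real.sqrt (d * Real.log (1 / δ)) := Real.sqrt_pos.2 (by positivity)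
  set Y := n * ε / Real.sqrt (d * Real.log (1 / δ)) with hY
  have hY0 : 0 < Y := by positivity
  have eY : C * n * ε / Real.sqrt (d * Real.log (1 / δ)) = C * Y := by
    rw [hY]
    ring
  rw [eY] at hT
  have hTle : (T : ℝ) ≤ C * Y := by
    rw [hT]
    exact Nat.floor_le (by positivity)
  -- The floor loses less than 1, and 1 ≤ T.
  have hTge : C * Y ≤ 2 * T := by
    have := Nat.lt_floor_add_one (C * Y)
    rw [← hT] at this
    linarith
  obtain ⟨hv, hvT⟩ := DPTD.mul_noiseVariance_le (G := G) hd hn hε hδ hδ' hβ₀ hβ₁ hC hc hT1 hTle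
  set v := DPTD.noiseVariance G n T ε δ β'
  have hν : ∀ t : ℕ, A.ν t = 1 / (4 * Real.sqrt (t + b)) := fun t => by
    rw [hAν, Real.sqrt_eq_rpow]
  have hsq : ∀ t : ℕ, 1 ≤ Real.sqrt (t + b) := fun t => by
    rw [Real.one_le_sqrt]
    linarith [(Nat.cast_nonneg t : (0 : ℝ) ≤ t)]
  have hset : DPTD.Setting f Ξ D A L_F G μ :=
    { assumptions := H
      lipschitz_nonneg := hG
      concavity_pos := hμ
      concavity_le := hμL
      steps := hsteps
      alpha := hAα
      beta := hAβ
      init_primal := hθ₀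
      init_dual := hω₀
      nu_pos := fun t => by
        rw [hν]
        have := hsq t
        positivity
      nu_le := fun t => by
        rw [hν]
        have := hsq t
        exact one_div_le_one_div_of_le (by norm_num) (by linarith) }
  set F := DPTD.objective f Ξ
  -- The reference level J₀ is J(θ₀) - Δ, so the initial excess of J is exactly Δ.
  have hJ : ∀ θ ∈ A.Θ, DPTD.primal F A.W A.θ₀ - Δ ≤ DPTD.primal F A.W θ := fun θ hθ => by
    linarith [hΔ θ hθ]
  set ν₀ := 1 / (4 * Real.sqrt (T + b)) with hν₀
  have hν₀pos : 0 < ν₀ := by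
    have := hsq T
    positivity
  have hsum := hset.sum_lintegral_metric_sq_le_ofReal hv hJ T hν₀pos fun t ht => by
    rw [hν, hν₀]
    have := hsq t
    have h1 : (t : ℝ) ≤ T := by exact_mod_cast ht.le
    exact one_div_le_one_div_of_le (by positivity)
      (mul_le_mul_of_nonneg_left (Real.sqrt_le_sqrt (by linarith)) (by norm_num))
  have hbudget := DPTD.budget_bound (L := L_F) (G := G) (Δ' := Δ) (Δ := Δ) (m := d * v)
    hμ hη hκ hb3 hT1 hν (le_abs_self Δ) (by positivity) hvT
  rw [sub_sub_cancel] at hsum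
  have hit : ∀ s, DPTD.metric F L_F A (DPTD.iterate f A (fun t => ζ t s) (R s))
      = DPTD.metric F L_F A (DPTD.toState (DPTD.path (DPTD.lossGradTheta f)
        (DPTD.lossGradOmega f) A (fun t => ζ t s) (R s))) := fun s => by
    rw [DPTD.iterate, DPTD.execute_eq]
  have hmeas : ∀ r : Fin T, Measurable fun z : ℕ → Z × DPTD.Vec d × DPTD.Vec d =>
      DPTD.metric F L_F A (DPTD.toState (DPTD.path (DPTD.lossGradTheta f)
        (DPTD.lossGradOmega f) A z r)) := fun r => hset.measurable_metric_path r
  have hlint := hR.lintegral_eq (Φ := fun r z => ENNReal.ofReal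
    (DPTD.metric F L_F A (DPTD.toState (DPTD.path (DPTD.lossGradTheta f)
        (DPTD.lossGradOmega f) A z r)) ^ 2)) fun r => ((hmeas r).pow_const 2).ennreal_ofReal
  have hTinv : (T : ENNReal)⁻¹ = ENNReal.ofReal ((T : ℝ)⁻¹) := by
    rw [ENNReal.ofReal_inv_of_pos (by linarith), ENNReal.ofReal_natCast]
  have hsecond := hlint.le
  rw [Fin.sum_univ_eq_sum_range (fun t => ∫⁻ z, ENNReal.ofReal
    (DPTD.metric F L_F A (DPTD.toState (DPTD.path (DPTD.lossGradTheta f)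
        (DPTD.lossGradOmega f) A z t)) ^ 2)
        ∂(Measure.infinitePi fun _ : ℕ => DPTD.stepLaw Ξ d v)) T] at hsecond
  have hfinal := hsecond.trans (mul_le_mul_right hsum _)
  rw [hTinv, ← ENNReal.ofReal_mul (by positivity)] at hfinal
  have hlast := DPTD.integrable_and_integral_le_sqrt (hR.aemeasurable_comp hmeas) hfinal
  set X := (d * Real.log (1 / δ)) ^ (1 / 8 : ℝ) / (n * ε) ^ (1 / 4 : ℝ) with hX
  have hX0 : 0 ≤ X := by positivity
  -- The exponents 1/8 and 1/4 of the rate are those for which X⁴ is the inverse of T/C up to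
  -- rounding.
  have hX4 : X ^ 4 = 1 / Y := by
    rw [hX, hY, div_pow, ← Real.rpow_natCast, ← Real.rpow_natCast, ← Real.rpow_mul (by positivity),
      ← Real.rpow_mul (by positivity), Real.sqrt_eq_rpow, one_div_div]
    norm_num
  have hTX : 1 ≤ 2 / C * X ^ 4 * T := by
    rw [hX4]
    have e : 2 / C * (1 / Y) * T = 2 * T / (C * Y) := by field_simp
    rw [e, le_div_iff₀ (by positivity)]
    linarith
  have hβ : 0 < 1 - β' := by linarith
  have hB : 0 ≤ DPTD.budget G L_F μ A.η A.κ β' C c Δ := by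
    rw [DPTD.budget, DPTD.errorWeight]
    positivity
  have hlog : 0 ≤ Real.log (T + b) := Real.log_nonneg (by linarith)
  have hbound := DPTD.sqrt_average_le hκ hb3 hB hlog hC hX0 hT1 hTX
  refine ⟨⟨?_, ?_⟩, fun s => ?_, ?_⟩
  · simp_rw [hit]
    exact hlast.1
  · simp_rw [hit]
    refine hlast.2.trans ((Real.sqrt_le_sqrt ?_).trans (hbound.trans ?_))
    · rw [DPTD.budget]
      gcongr
    · rw [← DPTD.utilityConstant]
      gcongr
      linarith
  · rw [DPTD.gradientComplexity, DPTD.execute_eq]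
  · have hK : 0 ≤ DPTD.utilityConstant G L_F μ A.η A.κ b β' C c Δ * Y :=
      mul_nonneg (Real.sqrt_nonneg _) hY0.le
    linarith
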